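/- Let $(\mathcal X,d)$ be a compact metric space with Borel probability measures $\alpha,\beta$, and let $C:\mathcal X\times\mathcal X\to\mathbb R$ be $L$-Lipschitz (for the metric $\max(d(x,x'),d(y,y'))$ on $\mathcal X\times\mathcal X$). For a continuous $f$ write $\|f\|_{\mathrm{var}}=\max f-\min f$. Let $(f^\star,g^\star)$ be optimal potentials of entropic optimal transport (with $\varepsilon=1$), i.e. continuous functions on $\mathcal X$ such that for all $x,y\in\mathcal X$ $$e^{-f^\star(x)}=\int e^{g^\star(y')-C(x,y')}\,d\beta(y'),\qquad e^{-g^\star(y)}=\int e^{f^\star(x')-C(x',y)}\,d\alpha(x').$$ Let $n\ge 1$ be a fixed batch size, let $(\eta_t)_{t\ge0}$ satisfy $0\le\eta_t\le1$, $\sum_t\eta_t=\infty$, $\sum_t\eta_t^2<\infty$, and let $x_0,x_1,\dots\sim\alpha$ and $y_0,y_1,\dots\sim\beta$ be random variables that are all mutually independent. Online Sinkhorn produces functions $f_t=-\log u_t$, $g_t=-\log v_t$ of the form $$u_t=\sum_{i<(t+1)n}e^{q_{i,t}-C(\cdot,y_i)},\qquad v_t=\sum_{i<(t+1)n}e^{p_{i,t}-C(x_i,\cdot)},$$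 where $q_{i,0}=p_{i,0}=0$ for $i<n$, and for $t\ge0$: if $i<(t+1)n$, then $q_{i,t+1}=q_{i,t}+\log(1-\eta_t)$ and $p_{i,t+1}=p_{i,t}+\log(1-\eta_t)$; if $(t+1)n\le i<(t+2)n$ (the new batch), then $q_{i,t+1}=\log\frac{\eta_t}{n}+g_t(y_i)$ and $p_{i,t+1}=\log\frac{\eta_t}{n}+f_t(x_i)$ (with $\log 0=-\infty$, $e^{-\infty}=0$). Equivalently, $$u_{t+1}=(1-\eta_t)u_t+\eta_t\,\frac1n\sum_{i=(t+1)n}^{(t+2)n-1}\frac{e^{-C(\cdot,y_i)}}{v_t(y_i)},\qquad v_{t+1}=(1-\eta_t)v_t+\eta_t\,\frac1n\sum_{i=(t+1)n}^{(t+2)n-1}\frac{e^{-C(x_i,\cdot)}}{u_t(x_i)}.$$ Then for every $L\geq 0$ and $D\ge 0$ there is a constant $A>0$, depending only on $L$ and $D$, such that for all data as above with $\operatorname{diam}(\mathcal X)\le D$ and for every $n$, almost surely there is a (random) $T$ such that for all $t>T$ $$\|f_t-f^\star\|_{\mathrm{var}}+\|g_t-g^\star\|_{\mathrm{var}}\le\frac{A}{\sqrt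 n}.$$ -/

import Mathlib

open MeasureTheory ProbabilityTheory Filter Topology
open scoped NNReal

noncomputable section

namespace OnlineSinkhorn

/-- The variation (semi)norm `max f - min f`. -/
def varNorm {X : Type*} (f : X → ℝ) : ℝ := (⨆ x, f x) - ⨅ x, f x

/-- The objective of the dual of entropy-regularised optimal transport (regularisation `ε = 1`). -/
def dualObjective {X : Type*} [TopologicalSpace X] [MeasurableSpace X] (C : X → X → ℝ)
    (α β : Measure X) (f g : C(X, ℝ)) : ℝ :=
  ∫ x, f x ∂α + ∫ y, g y ∂β - ∫ x, ∫ y, Real.exp (f x + g y - C x y) ∂β ∂α + 1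

/-- The operator whose roots are the exponentiated optimal potentials:
`(u, v) ↦ (u - ∫ κ_y / v(y) dβ(y), v - ∫ κ_x / u(x) dα(x))`, where
`κ_y = exp (-C(·, y))` and `κ_x = exp (-C(x, ·))`. -/
def sinkhornOp {X : Type*} [MeasurableSpace X] (C : X → X → ℝ) (α β : Measure X)
    (u v : X → ℝ) : (X → ℝ) × (X → ℝ) :=
  (fun x => u x - ∫ y, 1 / v y * Real.exp (-C x y) ∂β,
   fun y => v y - ∫ x, 1 / u x * Real.exp (-C x y) ∂α)

/-- Optimal potentials: continuous `f, g` such that `(exp (-f), exp (-g))` is a root of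
`sinkhornOp`, that is, `f` is the soft `C`-transform of `g` with respect to `β` and `g` is the
soft `C`-transform of `f` with respect to `α`, at every point of `X`. Such pairs solve
the dual problem (`IsOptimalPotentials.dualObjective_le` below). The equations are required on
all of `X`, since maximality alone leaves `f` and `g` undetermined off the supports of
`α` and `β`. -/
def IsOptimalPotentials {X : Type*} [TopologicalSpace X] [MeasurableSpace X] (C : X → X → ℝ)
    (α β : Measure X) (f g : C(X, ℝ)) : Prop :=
  sinkhornOp C α β (fun x => Real.exp (-f x)) (fun y => Real.exp (-g y)) = 0

/-- Step sizes: `0 ≤ η_t ≤ 1`, `∑ η_t = ∞`, `∑ η_t² < ∞`. -/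
structure IsRobbinsMonro (η : ℕ → ℝ) : Prop where
  nonneg : ∀ t, 0 ≤ η t
  le_one : ∀ t, η t ≤ 1
  sum_eq_top : Tendsto (fun T => ∑ t ∈ Finset.range T, η t) atTop atTop
  summable_sq : Summable (fun t => η t ^ 2)

/-- The function `∑_{i < N} w_i exp (-C(·, y_i))`; with `w_i = exp q_i` it is
`∑_{i < N} exp (q_i - C(·, y_i))`. -/
def kernelSum {X : Type*} (C : X → X → ℝ) (N : ℕ) (w : ℕ → ℝ) (y : ℕ → X) (z : X) : ℝ :=
  ∑ i ∈ Finset.range N, w i * Real.exp (-C z (y i))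

/-- The weights `(exp q_i, exp p_i)` of online Sinkhorn with batch size `n`, on the sample
streams `x` and `y`. They are kept in exponential scale, because a step size `η_t = 1` sets
`exp q_i` to `0`, i.e. `q_i = -∞`.

The first batch `i < n` starts with `q_i = p_i = 0`, that is, with weights `1`. After `t` steps the
samples `i < (t + 1) * n` are in use. Step `t` takes the new batch
`(t + 1) * n ≤ i < (t + 2) * n` and sets there `q_i = log (η_t / n) + g_t(y_i)` and
`p_i = log (η_t / n) + f_t(x_i)`, where `exp (-f_t) = ∑ exp (q_i - C(·, y_i))` and
`exp (-g_t) = ∑ exp (p_i - C(x_i, ·))` run over the samples in use; it adds `log (1 - η_t)`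
to all earlier `q_i` and `p_i`. -/
def weights {X : Type*} (C : X → X → ℝ) (n : ℕ) (η : ℕ → ℝ) (x y : ℕ → X) :
    ℕ → (ℕ → ℝ) × (ℕ → ℝ)
  | 0 => (fun _ => 1, fun _ => 1)
  | t + 1 =>
    let w := weights C n η x y t
    (fun i => if i < (t + 1) * n then (1 - η t) * w.1 i
        else η t / n * (1 / kernelSum (fun b a => C a b) ((t + 1) * n) w.2 x (y i)),
     fun i => if i < (t + 1) * n then (1 - η t) * w.2 i
        else η t / n * (1 / kernelSum C ((t + 1) * n) w.1 y (x i)))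

/-- The iterate `u_t = exp (-f_t) = ∑_i exp (q_i - C(·, y_i))`. -/
def uIter {X : Type*} (C : X → X → ℝ) (n : ℕ) (η : ℕ → ℝ) (x y : ℕ → X) (t : ℕ) : X → ℝ :=
  kernelSum C ((t + 1) * n) (weights C n η x y t).1 y

/-- The iterate `v_t = exp (-g_t) = ∑_i exp (p_i - C(x_i, ·))`. -/
def vIter {X : Type*} (C : X → X → ℝ) (n : ℕ) (η : ℕ → ℝ) (x y : ℕ → X) (t : ℕ) : X → ℝ :=
  kernelSum (fun b a => C a b) ((t + 1) * n) (weights C n η x y t).2 x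

/-- The online Sinkhorn potential `f_t = -log u_t`. -/
def fIter {X : Type*} (C : X → X → ℝ) (n : ℕ) (η : ℕ → ℝ) (x y : ℕ → X) (t : ℕ) (z : X) : ℝ :=
  -Real.log (uIter C n η x y t z)

/-- The online Sinkhorn potential `g_t = -log v_t`. -/
def gIter {X : Type*} (C : X → X → ℝ) (n : ℕ) (η : ℕ → ℝ) (x y : ℕ → X) (t : ℕ) (z : X) : ℝ :=
  -Real.log (vIter C n η x y t z)

/-- The weight updates are the stochastic approximation step
`u_{t+1} = (1 - η_t) u_t + η_t (1/n) ∑_{i in batch} κ_{y_i} / v_t(y_i)`. -/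
theorem uIter_succ {X : Type*} (C : X → X → ℝ) (n : ℕ) (η : ℕ → ℝ) (x y : ℕ → X) (t : ℕ)
    (z : X) :
    uIter C n η x y (t + 1) z = (1 - η t) * uIter C n η x y t z +
      η t * ((1 / n) * ∑ j ∈ Finset.range n, 1 / vIter C n η x y t (y ((t + 1) * n + j)) *
        Real.exp (-C z (y ((t + 1) * n + j)))) := by
  have e : (t + 1 + 1) * n = (t + 1) * n + n := by ring
  simp only [uIter, vIter]
  rw [kernelSum, e, Finset.sum_range_add, kernelSum, Finset.mul_sum, Finset.mul_sum,
    Finset.mul_sum]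
  congr 1
  · refine Finset.sum_congr rfl fun i hi => ?_
    simp only [weights, if_pos (Finset.mem_range.1 hi)]
    ring
  · refine Finset.sum_congr rfl fun i _ => ?_
    simp only [weights, if_neg (Nat.not_lt.2 (Nat.le_add_right _ i))]
    ring

/-- The same for `v_{t+1} = (1 - η_t) v_t + η_t (1/n) ∑_{i in batch} κ_{x_i} / u_t(x_i)`. -/
theorem vIter_succ {X : Type*} (C : X → X → ℝ) (n : ℕ) (η : ℕ → ℝ) (x y : ℕ → X) (t : ℕ)
    (z : X) :
    vIter C n η x y (t + 1) z = (1 - η t) * vIter C n η x y t z +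
      η t * ((1 / n) * ∑ j ∈ Finset.range n, 1 / uIter C n η x y t (x ((t + 1) * n + j)) *
        Real.exp (-C (x ((t + 1) * n + j)) z)) := by
  have e : (t + 1 + 1) * n = (t + 1) * n + n := by ring
  simp only [uIter, vIter]
  rw [kernelSum, e, Finset.sum_range_add, kernelSum, Finset.mul_sum, Finset.mul_sum,
    Finset.mul_sum]
  congr 1
  · refine Finset.sum_congr rfl fun i hi => ?_
    simp only [weights, if_pos (Finset.mem_range.1 hi)]
    ring
  · refine Finset.sum_congr rfl fun i _ => ?_
    simp only [weights, if_neg (Nat.not_lt.2 (Nat.le_add_right _ i))]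
    ring

/-- Optimal potentials maximise the dual objective over all pairs of continuous functions. -/
theorem IsOptimalPotentials.dualObjective_le {X : Type*} [MetricSpace X] [CompactSpace X]
    [MeasurableSpace X] [BorelSpace X] {C : X → X → ℝ}
    (hC : Continuous (fun p : X × X => C p.1 p.2)) {α β : Measure X} [IsProbabilityMeasure α]
    [IsProbabilityMeasure β] {f g : C(X, ℝ)} (h : IsOptimalPotentials C α β f g)
    (f' g' : C(X, ℝ)) : dualObjective C α β f' g' ≤ dualObjective C α β f g := by
  have int1 : ∀ {μ : Measure X} [IsProbabilityMeasure μ] {φ : X → ℝ}, Continuous φ →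
      Integrable φ μ := fun hφ =>
    hφ.integrable_of_hasCompactSupport (HasCompactSupport.of_compactSpace _)
  have int2 : ∀ {φ : X × X → ℝ}, Continuous φ → Integrable φ (α.prod β) := fun hφ =>
    hφ.integrable_of_hasCompactSupport (HasCompactSupport.of_compactSpace _)
  have h1 : ∀ a, ∫ b, Real.exp (f a + g b - C a b) ∂β = 1 := by
    intro a
    have := congrFun (congrArg Prod.fst h) a
    simp only [sinkhornOp, Prod.fst_zero, Pi.zero_apply, sub_eq_zero] at this
    have e : ∀ b, Real.exp (f a + g b - C a b)
        = Real.exp (f a) * (1 / Real.exp (-g b) * Real.exp (-C a b)) := by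
      intro b
      rw [one_div, ← Real.exp_neg, ← Real.exp_add, ← Real.exp_add]
      congr 1
      ring
    simp_rw [e]
    rw [integral_const_mul, ← this, ← Real.exp_add]
    simp
  have h2 : ∀ b, ∫ a, Real.exp (f a + g b - C a b) ∂α = 1 := by
    intro b
    have := congrFun (congrArg Prod.snd h) b
    simp only [sinkhornOp, Prod.snd_zero, Pi.zero_apply, sub_eq_zero] at this
    have e : ∀ a, Real.exp (f a + g b - C a b)
        = Real.exp (g b) * (1 / Real.exp (-f a) * Real.exp (-C a b)) := by
      intro a
      rw [one_div, ← Real.exp_neg, ← Real.exp_add, ← Real.exp_add]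
      congr 1
      ring
    simp_rw [e]
    rw [integral_const_mul, ← this, ← Real.exp_add]
    simp
  let k : X × X → ℝ := fun p => Real.exp (f p.1 + g p.2 - C p.1 p.2)
  have kc : Continuous k := by fun_prop
  have mf : ∀ φ : C(X, ℝ), ∫ p, φ p.1 * k p ∂(α.prod β) = ∫ a, φ a ∂α := by
    intro φ
    rw [integral_prod _ (int2 (by fun_prop))]
    refine integral_congr_ae (Eventually.of_forall fun a => ?_)
    simp only [k]
    rw [integral_const_mul, h1, mul_one]
  have mg : ∀ φ : C(X, ℝ), ∫ p, φ p.2 * k p ∂(α.prod β) = ∫ b, φ b ∂β := by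
    intro φ
    rw [integral_prod_symm _ (int2 (by fun_prop))]
    refine integral_congr_ae (Eventually.of_forall fun b => ?_)
    simp only [k]
    rw [integral_const_mul, h2, mul_one]
  have d1 : ∫ a, ∫ b, Real.exp (f' a + g' b - C a b) ∂β ∂α =
      ∫ p : X × X, Real.exp (f' p.1 + g' p.2 - C p.1 p.2) ∂(α.prod β) :=
    (integral_prod (fun p : X × X => Real.exp (f' p.1 + g' p.2 - C p.1 p.2))
      (int2 (by fun_prop))).symm
  have key : ∫ p, ((f' p.1 * k p - f p.1 * k p) + (g' p.2 * k p - g p.2 * k p) + k p)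
      ∂(α.prod β) ≤ ∫ p : X × X, Real.exp (f' p.1 + g' p.2 - C p.1 p.2) ∂(α.prod β) := by
    refine integral_mono (int2 (by fun_prop)) (int2 (by fun_prop)) fun p => ?_
    have e : Real.exp (f' p.1 + g' p.2 - C p.1 p.2)
        = Real.exp (f' p.1 - f p.1 + (g' p.2 - g p.2)) * k p := by
      simp only [k]
      rw [← Real.exp_add]
      congr 1
      ring
    have := mul_le_mul_of_nonneg_right
      (Real.add_one_le_exp (f' p.1 - f p.1 + (g' p.2 - g p.2))) (Real.exp_pos _ : 0 < k p).le
    simp only [e]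
    linarith
  have kint : ∫ p, k p ∂(α.prod β) = 1 := by
    rw [integral_prod _ (int2 kc)]
    simp only [k, h1]
    simp
  rw [integral_add (int2 (by fun_prop)) (int2 kc), integral_add (int2 (by fun_prop))
    (int2 (by fun_prop)), integral_sub (int2 (by fun_prop)) (int2 (by fun_prop)),
    integral_sub (int2 (by fun_prop)) (int2 (by fun_prop)), mf, mf, mg, mg, kint] at key
  simp only [dualObjective, d1, h1]
  simp only [integral_const, probReal_univ, smul_eq_mul, mul_one]
  linarith

end OnlineSinkhorn

end

namespace OnlineSinkhorn

/-! ### Real recursions with step sizes -/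

section Recursions

theorem tendsto_zero_of_contraction {η : ℕ → ℝ}
    (hsum : Tendsto (fun T => ∑ t ∈ Finset.range T, η t) atTop atTop) {c : ℝ} (hc : 0 < c)
    {z : ℕ → ℝ} (hz : ∀ t, 0 ≤ z t) {T : ℕ}
    (hstep : ∀ t ≥ T, z (t + 1) ≤ (1 - c * η t) * z t) : Tendsto z atTop (𝓝 0) := by
  set σ : ℕ → ℝ := fun T => ∑ t ∈ Finset.range T, η t with hσ
  have hb : ∀ t ≥ T, z t ≤ z T * Real.exp (-c * (σ t - σ T)) := by
    intro t ht
    induction t, ht using Nat.le_induction with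
    | base => simp
    | succ t ht ih =>
      have h1 : z (t + 1) ≤ Real.exp (-c * η t) * z t :=
        (hstep t ht).trans (mul_le_mul_of_nonneg_right
          (by linarith [Real.add_one_le_exp (-c * η t)]) (hz t))
      have h2 : σ (t + 1) = σ t + η t := Finset.sum_range_succ _ _
      calc z (t + 1) ≤ Real.exp (-c * η t) * z t := h1
        _ ≤ Real.exp (-c * η t) * (z T * Real.exp (-c * (σ t - σ T))) := by gcongr
        _ = z T * Real.exp (-c * (σ (t + 1) - σ T)) := by
          rw [mul_left_comm, ← Real.exp_add, h2]
          congr 2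
          ring
  have hlim : Tendsto (fun t => z T * Real.exp (-c * (σ t - σ T))) atTop (𝓝 0) := by
    rw [← mul_zero (z T)]
    refine Tendsto.const_mul _ (Real.tendsto_exp_atBot.comp ?_)
    exact (tendsto_atTop_add_const_right _ _ hsum).const_mul_atTop_of_neg (by linarith)
  exact tendsto_of_tendsto_of_tendsto_of_le_of_le' tendsto_const_nhds hlim
    (Eventually.of_forall hz) (eventually_atTop.2 ⟨T, hb⟩)

theorem tendsto_zero_of_perturbed_contraction {η : ℕ → ℝ} (hη : ∀ t, 0 ≤ η t)
    (hη0 : Tendsto η atTop (𝓝 0))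
    (hsum : Tendsto (fun T => ∑ t ∈ Finset.range T, η t) atTop atTop) {c : ℝ} (hc : 0 < c)
    {z e : ℕ → ℝ} (hz : ∀ t, 0 ≤ z t) (he : Tendsto e atTop (𝓝 0))
    (hstep : ∀ᶠ t in atTop, z (t + 1) ≤ (1 - c * η t) * z t + η t * e t) :
    Tendsto z atTop (𝓝 0) := by
  have key : ∀ ε > 0, Tendsto (fun t => max (z t - ε) 0) atTop (𝓝 0) := by
    intro ε hε
    have h1 : ∀ᶠ t in atTop, e t < c * ε := he.eventually (gt_mem_nhds (by positivity))
    have h2 : ∀ᶠ t in atTop, c * η t < 1 := by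
      have : Tendsto (fun t => c * η t) atTop (𝓝 (c * 0)) := hη0.const_mul c
      rw [mul_zero] at this
      exact this.eventually (gt_mem_nhds one_pos)
    obtain ⟨T, hT⟩ := eventually_atTop.1 (hstep.and (h1.and h2))
    refine tendsto_zero_of_contraction hsum hc (fun t => le_max_right _ _) (T := T)
      fun t ht => ?_
    obtain ⟨a, b, d⟩ := hT t ht
    have h3 : 0 ≤ 1 - c * η t := by linarith
    refine max_le ?_ (mul_nonneg h3 (le_max_right _ _))
    have h4 : η t * e t ≤ η t * (c * ε) := mul_le_mul_of_nonneg_left b.le (hη t)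
    have h5 := mul_le_mul_of_nonneg_left (le_max_left (z t - ε) 0) h3
    nlinarith
  rw [Metric.tendsto_atTop]
  intro ε hε
  obtain ⟨T, hT⟩ := (Metric.tendsto_atTop.1 (key (ε / 2) (by positivity))) (ε / 2) (by positivity)
  refine ⟨T, fun t ht => ?_⟩
  have h := hT t ht
  rw [Real.dist_eq, sub_zero] at h ⊢
  rw [abs_of_nonneg (hz t)]
  have h6 := (le_max_left (z t - ε / 2) 0).trans_lt ((le_abs_self _).trans_lt h)
  linarith

/-- A recursion with increments `d` whose series converges, and a vanishing bias `e`,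
still contracts to zero. -/
theorem tendsto_zero_of_noisy_contraction {η : ℕ → ℝ} (hη : ∀ t, 0 ≤ η t)
    (hη0 : Tendsto η atTop (𝓝 0))
    (hsum : Tendsto (fun T => ∑ t ∈ Finset.range T, η t) atTop atTop) {c₀ c₁ : ℝ} (hc : 0 < c₀)
    {x θ e d : ℕ → ℝ} (hθ : ∀ t, c₀ ≤ θ t) (hθ' : ∀ t, θ t ≤ c₁)
    (he : Tendsto e atTop (𝓝 0)) {ℓ : ℝ}
    (hd : Tendsto (fun T => ∑ t ∈ Finset.range T, d t) atTop (𝓝 ℓ))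
    (hstep : ∀ t, x (t + 1) = x t - η t * (θ t * x t) + η t * e t + d t) :
    Tendsto x atTop (𝓝 0) := by
  set R : ℕ → ℝ := fun T => ℓ - ∑ t ∈ Finset.range T, d t with hR
  have hR0 : Tendsto R atTop (𝓝 0) := by
    rw [← sub_self ℓ]
    exact hd.const_sub ℓ
  have hRs : ∀ t, R (t + 1) = R t - d t := fun t => by
    simp only [hR, Finset.sum_range_succ]
    ring
  have hy : Tendsto (fun t => |x t + R t|) atTop (𝓝 0) := by
    refine tendsto_zero_of_perturbed_contraction hη hη0 hsum hc (e := fun t => |e t| + c₁ * |R t|)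
      (fun t => abs_nonneg _) ?_ ?_
    · simpa using he.abs.add (hR0.abs.const_mul c₁)
    · have h2 : ∀ᶠ t in atTop, c₁ * η t < 1 := by
        have : Tendsto (fun t => c₁ * η t) atTop (𝓝 (c₁ * 0)) := hη0.const_mul c₁
        rw [mul_zero] at this
        exact this.eventually (gt_mem_nhds one_pos)
      filter_upwards [h2] with t ht
      have e1 : x (t + 1) + R (t + 1)
          = (1 - η t * θ t) * (x t + R t) + η t * (e t + θ t * R t) := by
        rw [hstep, hRs]
        ring
      have h3 : 0 ≤ 1 - η t * θ t := by nlinarith [hη t, hθ' t]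
      have hθ0 : 0 ≤ θ t := hc.le.trans (hθ t)
      rw [e1]
      refine (abs_add_le _ _).trans (add_le_add ?_ ?_)
      · rw [abs_mul, abs_of_nonneg h3]
        refine mul_le_mul_of_nonneg_right ?_ (abs_nonneg _)
        nlinarith [hη t, hθ t]
      · rw [abs_mul, abs_of_nonneg (hη t)]
        refine mul_le_mul_of_nonneg_left ((abs_add_le _ _).trans ?_) (hη t)
        rw [abs_mul, abs_of_nonneg hθ0]
        gcongr
        exact hθ' t
  have := (tendsto_zero_iff_abs_tendsto_zero _).2 hy
  simpa using this.sub hR0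

/-- Descent with quadratic decrease and increments `d` whose series converges. -/
theorem tendsto_zero_of_noisy_descent {η : ℕ → ℝ} (hη : ∀ t, 0 ≤ η t)
    (hsum : Tendsto (fun T => ∑ t ∈ Finset.range T, η t) atTop atTop) {c : ℝ} (hc : 0 < c)
    {V d : ℕ → ℝ} (hV : ∀ t, 0 ≤ V t) {ℓ : ℝ}
    (hd : Tendsto (fun T => ∑ t ∈ Finset.range T, d t) atTop (𝓝 ℓ))
    (hstep : ∀ t, V (t + 1) ≤ V t - c * η t * V t ^ 2 + d t) :
    Tendsto V atTop (𝓝 0) := by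
  set S : ℕ → ℝ := fun T => ∑ t ∈ Finset.range T, d t with hS
  have hSs : ∀ t, S (t + 1) = S t + d t := fun t => Finset.sum_range_succ _ _
  set W : ℕ → ℝ := fun t => V t - S t with hW
  have hWs : ∀ t, W (t + 1) ≤ W t - c * η t * V t ^ 2 := fun t => by
    simp only [hW, hSs]
    linarith [hstep t]
  have hanti : Antitone W := antitone_nat_of_succ_le fun t =>
    (hWs t).trans (by nlinarith [mul_nonneg (mul_nonneg hc.le (hη t)) (sq_nonneg (V t))])
  obtain ⟨b, hb⟩ := hd.bddAbove_range
  have hbdd : BddBelow (Set.range W) := ⟨-b, by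
    rintro _ ⟨t, rfl⟩
    have := hb ⟨t, rfl⟩
    simp only [hW]
    linarith [hV t]⟩
  obtain ⟨w, hw⟩ : ∃ w, Tendsto W atTop (𝓝 w) := ⟨_, tendsto_atTop_ciInf hanti hbdd⟩
  have hVl : Tendsto V atTop (𝓝 (w + ℓ)) := by
    have := hw.add hd
    refine this.congr fun t => ?_
    simp [hW, hS]
  have hnn : 0 ≤ w + ℓ := ge_of_tendsto' hVl hV
  rcases hnn.eq_or_lt with h0 | h0
  · rwa [← h0] at hVl
  exfalso
  obtain ⟨T, hT⟩ := eventually_atTop.1 (hVl.eventually (lt_mem_nhds (half_lt_self h0)))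
  set q := c * ((w + ℓ) / 2) ^ 2 with hq
  have hq0 : 0 < q := by positivity
  have hdec : ∀ t ≥ T, W t + q * ∑ s ∈ Finset.range t, η s
      ≤ W T + q * ∑ s ∈ Finset.range T, η s := by
    intro t ht
    induction t, ht using Nat.le_induction with
    | base => exact le_rfl
    | succ t ht ih =>
      rw [Finset.sum_range_succ]
      have h1 : ((w + ℓ) / 2) ^ 2 ≤ V t ^ 2 :=
        pow_le_pow_left₀ (by positivity) (hT t ht).le 2
      have h2 := mul_le_mul_of_nonneg_left h1 (mul_nonneg hc.le (hη t))
      have := hWs t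
      have e : c * η t * ((w + ℓ) / 2) ^ 2 = q * η t := by rw [hq]; ring
      linarith
  have htop : Tendsto (fun t => W t + q * ∑ s ∈ Finset.range t, η s) atTop atTop :=
    hw.add_atTop (hsum.const_mul_atTop hq0)
  obtain ⟨T', hT'⟩ := eventually_atTop.1
    (htop.eventually (eventually_gt_atTop (W T + q * ∑ s ∈ Finset.range T, η s)))
  have h1 := hT' (max T T') (le_max_right _ _)
  have h2 := hdec (max T T') (le_max_left _ _)
  linarith

theorem IsRobbinsMonro.tendsto_zero {η : ℕ → ℝ} (h : IsRobbinsMonro η) :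
    Tendsto η atTop (𝓝 0) := by
  have := h.summable_sq.tendsto_atTop_zero.sqrt
  simpa [Real.sqrt_sq (h.nonneg _)] using this

theorem exists_tendsto_of_abs_sub_le {a b r : ℕ → ℝ} (hr : Summable r) {ℓ : ℝ}
    (ha : Tendsto (fun T => ∑ t ∈ Finset.range T, a t) atTop (𝓝 ℓ))
    (hab : ∀ t, |b t - a t| ≤ r t) :
    ∃ ℓ', Tendsto (fun T => ∑ t ∈ Finset.range T, b t) atTop (𝓝 ℓ') := by
  have hs : Summable fun t => b t - a t := Summable.of_norm_bounded hr hab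
  refine ⟨ℓ + ∑' t, (b t - a t), (ha.add hs.hasSum.tendsto_sum_nat).congr fun T => ?_⟩
  rw [← Finset.sum_add_distrib]
  exact Finset.sum_congr rfl fun t _ => by ring

end Recursions

/-! ### Elementary inequalities for the exponential and the logarithm -/

section ExpLog

theorem exp_sub_one_sub_le (d : ℝ) : Real.exp d - 1 - d ≤ d ^ 2 * Real.exp |d| := by
  have h1 : Real.exp d - 1 ≤ d * Real.exp d := by
    have h := Real.add_one_le_exp (-d)
    have h2 := mul_le_mul_of_nonneg_right h (Real.exp_pos d).le
    rw [← Real.exp_add, neg_add_cancel, Real.exp_zero] at h2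
    linarith
  rcases le_total 0 d with hd | hd
  · rw [abs_of_nonneg hd]
    nlinarith [Real.add_one_le_exp d]
  · have h2 : 1 ≤ Real.exp |d| := Real.one_le_exp (abs_nonneg d)
    have h3 := Real.add_one_le_exp d
    nlinarith [sq_nonneg d]

theorem abs_exp_sub_one_le {S s : ℝ} (hs : |s| ≤ S) : |Real.exp s - 1| ≤ Real.exp S * |s| := by
  have h1 : Real.exp s - 1 ≤ s * Real.exp s := by
    have h := Real.add_one_le_exp (-s)
    have h2 := mul_le_mul_of_nonneg_right h (Real.exp_pos s).le
    rw [← Real.exp_add, neg_add_cancel, Real.exp_zero] at h2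
    linarith
  have h0 : 0 ≤ S := (abs_nonneg s).trans hs
  have h3 := Real.add_one_le_exp s
  have h4 : 1 ≤ Real.exp S := Real.one_le_exp h0
  have h5 : Real.exp s ≤ Real.exp S := Real.exp_le_exp.2 ((le_abs_self s).trans hs)
  rcases le_total 0 s with hd | hd
  · rw [abs_of_nonneg hd, abs_of_nonneg (by linarith)]
    nlinarith
  · rw [abs_of_nonpos hd, abs_of_nonpos (by linarith [Real.exp_le_one_iff.2 hd])]
    nlinarith

theorem sq_le_mul_exp_sub_one_sub {S s : ℝ} (hs : |s| ≤ S) :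
    s ^ 2 ≤ (2 * S + 4) * (Real.exp s - 1 - s) := by
  have h0 : 0 ≤ S := (abs_nonneg s).trans hs
  have hn : 0 ≤ Real.exp s - 1 - s := by linarith [Real.add_one_le_exp s]
  rcases le_total (-2) s with h | h
  · have h1 : (1 + s / 2) ^ 2 ≤ Real.exp s := by
      have : Real.exp s = Real.exp (s / 2) ^ 2 := by
        rw [← Real.exp_nat_mul]
        congr 1
        push_cast
        ring
      rw [this]
      exact pow_le_pow_left₀ (by linarith) (by linarith [Real.add_one_le_exp (s / 2)]) 2
    nlinarith
  · have h1 : -s ≤ S := (neg_le_abs s).trans hs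
    have h2 := Real.exp_pos s
    nlinarith

theorem abs_log_one_add_sub_le {m x : ℝ} (hm : 0 < m) (hx : m ≤ 1 + x) :
    |Real.log (1 + x) - x| ≤ x ^ 2 / m := by
  have hp : 0 < 1 + x := hm.trans_le hx
  have h1 : Real.log (1 + x) ≤ x := by linarith [Real.log_le_sub_one_of_pos hp]
  have h2 : 1 - (1 + x)⁻¹ ≤ Real.log (1 + x) := Real.one_sub_inv_le_log_of_pos hp
  rw [abs_of_nonpos (by linarith), neg_sub]
  have h3 : x - (1 - (1 + x)⁻¹) = x ^ 2 / (1 + x) := by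
    field_simp
    ring
  calc x - Real.log (1 + x) ≤ x - (1 - (1 + x)⁻¹) := by linarith
    _ = x ^ 2 / (1 + x) := h3
    _ ≤ x ^ 2 / m := by gcongr

end ExpLog

/-! ### Almost sure convergence of martingale noise -/

section Noise

/-- A series of bounded martingale differences with square-summable coefficients converges
almost surely. -/
theorem ae_exists_tendsto_sum_of_centered {Ω : Type*} {mΩ : MeasurableSpace Ω} {P : Measure Ω}
    [IsProbabilityMeasure P] (F : Filtration ℕ mΩ) {ξ : ℕ → Ω → ℝ} {B : ℝ} {η : ℕ → ℝ}
    (hη : Summable fun t => η t ^ 2) (hξ : ∀ t, Measurable[F (t + 1)] (ξ t))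
    (hB : ∀ t ω, |ξ t ω| ≤ B)
    (horth : ∀ t, ∀ g : Ω → ℝ, Measurable[F t] g → (∃ K, ∀ ω, |g ω| ≤ K) →
      ∫ ω, g ω * ξ t ω ∂P = 0) :
    ∀ᵐ ω ∂P, ∃ ℓ, Tendsto (fun T => ∑ t ∈ Finset.range T, η t * ξ t ω) atTop (𝓝 ℓ) := by
  set M : ℕ → Ω → ℝ := fun T ω => ∑ t ∈ Finset.range T, η t * ξ t ω with hM
  have hMs : ∀ T ω, M (T + 1) ω = M T ω + η T * ξ T ω := fun T ω => Finset.sum_range_succ _ _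
  have hMm : ∀ T, Measurable[F T] (M T) := by
    intro T
    refine Finset.measurable_fun_sum _ fun t ht => ?_
    exact ((hξ t).mono (F.mono (Finset.mem_range.1 ht)) le_rfl).const_mul _
  have hMm' : ∀ T, Measurable (M T) := fun T => (hMm T).mono (F.le T) le_rfl
  have hξm : ∀ t, Measurable (ξ t) := fun t => (hξ t).mono (F.le _) le_rfl
  have hMb : ∀ T, ∃ K, ∀ ω, |M T ω| ≤ K := by
    intro T
    refine ⟨∑ t ∈ Finset.range T, |η t| * B, fun ω =>
      (Finset.abs_sum_le_sum_abs _ _).trans (Finset.sum_le_sum fun t _ => ?_)⟩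
    rw [abs_mul]
    exact mul_le_mul_of_nonneg_left (hB t ω) (abs_nonneg _)
  have intb : ∀ {f : Ω → ℝ}, Measurable f → (∃ K, ∀ ω, |f ω| ≤ K) → Integrable f P := by
    rintro f hf ⟨K, hK⟩
    exact Integrable.of_bound hf.aestronglyMeasurable K (Eventually.of_forall hK)
  have hMi : ∀ T, Integrable (M T) P := fun T => intb (hMm' T) (hMb T)
  have hξi : ∀ t, Integrable (ξ t) P := fun t => intb (hξm t) ⟨B, hB t⟩
  have hmart : Martingale M F P := by
    refine martingale_of_setIntegral_eq_succ (fun T => (hMm T).stronglyMeasurable) hMi ?_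
    intro T s hs
    have hs' : MeasurableSet s := F.le T s hs
    have h0 := horth T (s.indicator fun _ => 1) (measurable_const.indicator hs)
      ⟨1, fun ω => by by_cases h : ω ∈ s <;> simp [h]⟩
    have h1 : ∫ ω in s, ξ T ω ∂P = 0 := by
      rw [← integral_indicator hs', ← h0]
      refine integral_congr_ae (Eventually.of_forall fun ω => ?_)
      by_cases h : ω ∈ s <;> simp [h]
    simp only [hMs]
    rw [integral_add (hMi T).integrableOn ((hξi T).const_mul _).integrableOn,
      integral_const_mul, h1]
    simp
  have hsq : ∀ T, ∫ ω, M T ω ^ 2 ∂P ≤ B ^ 2 * ∑ t ∈ Finset.range T, η t ^ 2 := by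
    intro T
    induction T with
    | zero => simp [hM]
    | succ T ih =>
      obtain ⟨K, hK⟩ := hMb T
      have hK0 : ∀ ω, 0 ≤ K := fun ω => (abs_nonneg _).trans (hK ω)
      have i1 : Integrable (fun ω => M T ω ^ 2) P := intb ((hMm' T).pow_const 2)
        ⟨K ^ 2, fun ω => by rw [abs_pow]; exact pow_le_pow_left₀ (abs_nonneg _) (hK ω) 2⟩
      have i2 : Integrable (fun ω => M T ω * ξ T ω) P := intb ((hMm' T).mul (hξm T))
        ⟨K * B, fun ω => by
          rw [abs_mul]
          exact mul_le_mul (hK ω) (hB T ω) (abs_nonneg _) (hK0 ω)⟩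
      have i3 : Integrable (fun ω => ξ T ω ^ 2) P := intb ((hξm T).pow_const 2)
        ⟨B ^ 2, fun ω => by rw [abs_pow]; exact pow_le_pow_left₀ (abs_nonneg _) (hB T ω) 2⟩
      have e : ∀ ω, M (T + 1) ω ^ 2
          = M T ω ^ 2 + (2 * η T) * (M T ω * ξ T ω) + η T ^ 2 * ξ T ω ^ 2 := fun ω => by
        rw [hMs]
        ring
      have h3 : ∫ ω, ξ T ω ^ 2 ∂P ≤ B ^ 2 := by
        refine (integral_mono i3 (integrable_const (B ^ 2)) fun ω => ?_).trans (by simp)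
        exact sq_le_sq' (by linarith [neg_abs_le (ξ T ω), hB T ω])
          ((le_abs_self _).trans (hB T ω))
      simp_rw [e]
      rw [integral_add (f := fun ω => M T ω ^ 2 + (2 * η T) * (M T ω * ξ T ω))
        (i1.add (i2.const_mul _)) (i3.const_mul _), integral_add i1
        (i2.const_mul _), integral_const_mul, integral_const_mul, horth T (M T) (hMm T) (hMb T),
        Finset.sum_range_succ]
      have := mul_le_mul_of_nonneg_left h3 (sq_nonneg (η T))
      linarith
  set R : ℝ≥0 := Real.toNNReal (1 + B ^ 2 * ∑' t, η t ^ 2) with hR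
  refine hmart.submartingale.exists_ae_tendsto_of_bdd (R := R) fun T => ?_
  obtain ⟨K, hK⟩ := hMb T
  have i1 : Integrable (fun ω => M T ω ^ 2) P := intb ((hMm' T).pow_const 2)
    ⟨K ^ 2, fun ω => by rw [abs_pow]; exact pow_le_pow_left₀ (abs_nonneg _) (hK ω) 2⟩
  have h1 : ∫ ω, ‖M T ω‖ ∂P ≤ 1 + B ^ 2 * ∑' t, η t ^ 2 := by
    calc ∫ ω, ‖M T ω‖ ∂P ≤ ∫ ω, (1 + M T ω ^ 2) ∂P := by
          refine integral_mono (hMi T).norm ((integrable_const _).add i1) fun ω => ?_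
          simp only [Real.norm_eq_abs]
          nlinarith [sq_abs (M T ω), sq_nonneg (|M T ω| - 1), abs_nonneg (M T ω)]
      _ = 1 + ∫ ω, M T ω ^ 2 ∂P := by
          rw [integral_add (integrable_const _) i1]
          simp
      _ ≤ 1 + B ^ 2 * ∑' t, η t ^ 2 := by
          have := hη.sum_le_tsum (Finset.range T) fun t _ => sq_nonneg (η t)
          have := mul_le_mul_of_nonneg_left this (sq_nonneg B)
          linarith [hsq T]
  rw [eLpNorm_one_eq_lintegral_enorm, ← ofReal_integral_norm_eq_lintegral_enorm (hMi T)]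
  exact ENNReal.ofReal_le_ofReal h1

theorem measurable_integral_right {S X : Type*} [MeasurableSpace S] [MeasurableSpace X]
    (μ : Measure X) [SFinite μ] {Ψ : S → X → ℝ} (hΨ : Measurable (Function.uncurry Ψ)) :
    Measurable fun s => ∫ x, Ψ s x ∂μ :=
  (hΨ.stronglyMeasurable.integral_prod_right (ν := μ)).measurable

/-- Centering in a variable independent of `H` kills the integral against functions of `H`. -/
theorem integral_mul_centered_eq_zero {Ω S X : Type*} {mΩ : MeasurableSpace Ω}
    [MeasurableSpace S] [MeasurableSpace X] {P : Measure Ω} [IsProbabilityMeasure P]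
    {H : Ω → S} {Y : Ω → X} (hH : Measurable H) (hY : Measurable Y) (hind : IndepFun H Y P)
    {Ψ : S → X → ℝ} (hΨ : Measurable (Function.uncurry Ψ)) {B : ℝ} (hB : ∀ s x, |Ψ s x| ≤ B)
    {g : S → ℝ} (hg : Measurable g) {K : ℝ} (hK : ∀ s, |g s| ≤ K) :
    ∫ ω, g (H ω) * (Ψ (H ω) (Y ω) - ∫ x, Ψ (H ω) x ∂(P.map Y)) ∂P = 0 := by
  have : IsProbabilityMeasure (P.map H) := Measure.isProbabilityMeasure_map hH.aemeasurable
  have : IsProbabilityMeasure (P.map Y) := Measure.isProbabilityMeasure_map hY.aemeasurable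
  have hmap := hind.map_prod_eq_prod_map_map hH.aemeasurable hY.aemeasurable
  have hI : Measurable fun s => ∫ x, Ψ s x ∂(P.map Y) := measurable_integral_right _ hΨ
  have hIb : ∀ s, |∫ x, Ψ s x ∂(P.map Y)| ≤ B := fun s => by
    have := norm_integral_le_of_norm_le_const (μ := P.map Y) (f := Ψ s)
      (Eventually.of_forall (hB s))
    simpa using this
  set Φ : S × X → ℝ := fun p => g p.1 * (Ψ p.1 p.2 - ∫ x, Ψ p.1 x ∂(P.map Y)) with hΦ
  have hΦm : Measurable Φ := (hg.comp measurable_fst).mul (hΨ.sub (hI.comp measurable_fst))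
  have hΦb : ∀ p, ‖Φ p‖ ≤ K * (B + B) := fun p => by
    rw [hΦ, Real.norm_eq_abs, abs_mul]
    exact mul_le_mul (hK _) ((abs_sub _ _).trans (add_le_add (hB _ _) (hIb _))) (abs_nonneg _)
      ((abs_nonneg _).trans (hK p.1))
  have h1 : ∫ ω, Φ (H ω, Y ω) ∂P = ∫ p, Φ p ∂(P.map fun ω => (H ω, Y ω)) :=
    (integral_map (hH.prodMk hY).aemeasurable hΦm.aestronglyMeasurable).symm
  change ∫ ω, Φ (H ω, Y ω) ∂P = 0
  rw [h1, hmap, integral_prod _ (Integrable.of_bound hΦm.aestronglyMeasurable _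
    (Eventually.of_forall hΦb))]
  refine integral_eq_zero_of_ae (Eventually.of_forall fun s => ?_)
  have hΨs : Integrable (Ψ s) (P.map Y) := Integrable.of_bound
    (hΨ.comp measurable_prodMk_left).aestronglyMeasurable B (Eventually.of_forall (hB s))
  simp only [hΦ, Pi.zero_apply]
  rw [integral_const_mul, integral_sub hΨs (integrable_const _)]
  simp

/-- The information in the samples used up to time `t`. -/
def sampleFiltration {Ω X : Type*} {mΩ : MeasurableSpace Ω} {mX : MeasurableSpace X} (n : ℕ)
    (w : ℕ ⊕ ℕ → Ω → X) (hw : ∀ i, Measurable (w i)) : Filtration ℕ mΩ where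
  seq t := ⨆ (i : ℕ ⊕ ℕ) (_ : Sum.elim id id i < (t + 1) * n), MeasurableSpace.comap (w i) mX
  mono' _ _ hst := iSup_mono fun _ => iSup_mono' fun hi =>
    ⟨lt_of_lt_of_le hi (Nat.mul_le_mul_right n (Nat.succ_le_succ hst)), le_rfl⟩
  le' _ := iSup₂_le fun i _ => (hw i).comap_le

theorem measurable_sampleFiltration {Ω X : Type*} {mΩ : MeasurableSpace Ω} {mX : MeasurableSpace X}
    {n : ℕ} {w : ℕ ⊕ ℕ → Ω → X} (hw : ∀ i, Measurable (w i)) {t : ℕ} {i : ℕ ⊕ ℕ}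
    (hi : Sum.elim id id i < (t + 1) * n) : Measurable[sampleFiltration n w hw t] (w i) := by
  rw [measurable_iff_comap_le]
  exact le_iSup₂_of_le (f := fun (i : ℕ ⊕ ℕ) (_ : Sum.elim id id i < (t + 1) * n) =>
      MeasurableSpace.comap (w i) mX) i hi le_rfl

theorem indep_sampleFiltration {Ω X : Type*} {mΩ : MeasurableSpace Ω} {mX : MeasurableSpace X}
    {P : Measure Ω} {n : ℕ} {w : ℕ ⊕ ℕ → Ω → X} (hw : ∀ i, Measurable (w i))
    (hind : iIndepFun w P) {t : ℕ} {i : ℕ ⊕ ℕ} (hi : (t + 1) * n ≤ Sum.elim id id i) :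
    Indep (sampleFiltration n w hw t) (MeasurableSpace.comap (w i) mX) P := by
  have h := indep_iSup_of_disjoint (fun i => (hw i).comap_le)
    ((iIndepFun_iff_iIndep _ _ _).1 hind)
    (S := {i : ℕ ⊕ ℕ | Sum.elim id id i < (t + 1) * n}) (T := {i})
    (Set.disjoint_singleton_right.2 fun h => (Nat.not_lt.2 hi) h)
  simp only [Set.mem_singleton_iff, iSup_iSup_eq_left, Set.mem_ofPred_eq] at h
  exact h

/-- The centered minibatch averages of bounded predictable functions form a convergent series when
weighted by square-summable step sizes. -/
theorem ae_exists_tendsto_sum_batch {Ω X : Type*} {mΩ : MeasurableSpace Ω} {mX : MeasurableSpace X}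
    {P : Measure Ω} [IsProbabilityMeasure P] {n : ℕ} (hn : 0 < n) {w : ℕ ⊕ ℕ → Ω → X}
    (hw : ∀ i, Measurable (w i)) (hind : iIndepFun w P) {η : ℕ → ℝ}
    (hη : Summable fun t => η t ^ 2) {σ : ℕ → ℕ ⊕ ℕ} (hσ : ∀ i, Sum.elim id id (σ i) = i)
    {μ : Measure X} (hμ : ∀ i, P.map (w (σ i)) = μ) {Ψ : ℕ → Ω → X → ℝ}
    (hΨ : ∀ t, Measurable[(sampleFiltration n w hw t).prod mX] (Function.uncurry (Ψ t)))
    {B : ℝ} (hB : ∀ t ω x, |Ψ t ω x| ≤ B) :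
    ∀ᵐ ω ∂P, ∃ ℓ, Tendsto (fun T => ∑ t ∈ Finset.range T, η t *
      ((1 / n) * ∑ j ∈ Finset.range n, Ψ t ω (w (σ ((t + 1) * n + j)) ω) -
        ∫ x, Ψ t ω x ∂μ)) atTop (𝓝 ℓ) := by
  have hprob : IsProbabilityMeasure μ :=
    hμ 0 ▸ Measure.isProbabilityMeasure_map (hw _).aemeasurable
  have hnR : (n : ℝ) ≠ 0 := Nat.cast_ne_zero.2 hn.ne'
  set F := sampleFiltration n w hw with hF
  have hlt : ∀ {t j : ℕ}, j ∈ Finset.range n →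
      Sum.elim id id (σ ((t + 1) * n + j)) < (t + 1 + 1) * n := fun {t j} hj => by
    rw [hσ, Nat.add_mul (t + 1) 1 n, one_mul]
    exact Nat.add_lt_add_left (Finset.mem_range.1 hj) _
  have hIb : ∀ t ω, |∫ x, Ψ t ω x ∂μ| ≤ B := fun t ω => by
    have := norm_integral_le_of_norm_le_const (μ := μ) (f := Ψ t ω)
      (Eventually.of_forall (hB t ω))
    simpa using this
  have hΨ1 : ∀ t j, j ∈ Finset.range n →
      Measurable[F (t + 1)] fun ω => Ψ t ω (w (σ ((t + 1) * n + j)) ω) := by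
    intro t j hj
    have h1 : Measurable[F (t + 1)] (w (σ ((t + 1) * n + j))) :=
      measurable_sampleFiltration hw (hlt hj)
    have h2 : @Measurable Ω Ω (F (t + 1)) (F t) id :=
      measurable_id'' (F.mono (Nat.le_succ t))
    have h3 := @Measurable.prodMk Ω (F (t + 1)) Ω X (F t) mX _ _ h2 h1
    exact (hΨ t).comp h3
  have hI : ∀ t, Measurable[F t] fun ω => ∫ x, Ψ t ω x ∂μ := fun t =>
    @measurable_integral_right Ω X (F t) mX μ _ (Ψ t) (hΨ t)
  refine ae_exists_tendsto_sum_of_centered F (B := B + B) hη (fun t => ?_) (fun t ω => ?_)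
    (fun t g hg ⟨K, hK⟩ => ?_)
  · exact ((Finset.measurable_fun_sum _ fun j hj => hΨ1 t j hj).const_mul _).sub
      ((hI t).mono (F.mono (Nat.le_succ t)) le_rfl)
  · refine (abs_sub _ _).trans (add_le_add ?_ (hIb t ω))
    rw [abs_mul, abs_of_nonneg (by positivity : (0 : ℝ) ≤ 1 / n)]
    have : |∑ j ∈ Finset.range n, Ψ t ω (w (σ ((t + 1) * n + j)) ω)| ≤ n * B := by
      refine (Finset.abs_sum_le_sum_abs _ _).trans
        ((Finset.sum_le_sum fun j _ => hB t ω _).trans ?_)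
      simp
    calc 1 / (n : ℝ) * _ ≤ 1 / n * (n * B) := by gcongr
      _ = B := by field_simp
  · have key : ∀ j, ∫ ω, g ω * (Ψ t ω (w (σ ((t + 1) * n + j)) ω) - ∫ x, Ψ t ω x ∂μ) ∂P = 0 := by
      intro j
      have hi : Indep (F t) (MeasurableSpace.comap (w (σ ((t + 1) * n + j))) mX) P :=
        indep_sampleFiltration hw hind (by rw [hσ]; exact Nat.le_add_right _ _)
      have h2 : @Measurable Ω Ω mΩ (F t) id := measurable_id'' (F.le t)
      have hif : @IndepFun Ω Ω X mΩ (F t) _ id (w (σ ((t + 1) * n + j))) P := by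
        refine (@IndepFun_iff_Indep Ω Ω X mΩ (F t) mX id _ P).2 ?_
        rw [MeasurableSpace.comap_id]
        exact hi
      have := @integral_mul_centered_eq_zero Ω Ω X mΩ (F t) _ P _ id _ h2 (hw _) hif (Ψ t) (hΨ t)
        B (hB t) g hg K hK
      rwa [hμ] at this
    have e : ∀ ω, g ω * ((1 / n) * ∑ j ∈ Finset.range n, Ψ t ω (w (σ ((t + 1) * n + j)) ω) -
        ∫ x, Ψ t ω x ∂μ) = ∑ j ∈ Finset.range n, (1 / n : ℝ) *
          (g ω * (Ψ t ω (w (σ ((t + 1) * n + j)) ω) - ∫ x, Ψ t ω x ∂μ)) := fun ω => by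
      rw [← Finset.mul_sum, ← Finset.mul_sum, Finset.sum_sub_distrib]
      simp only [Finset.sum_const, Finset.card_range, nsmul_eq_mul]
      field_simp
    simp_rw [e]
    rw [integral_finsetSum]
    · simp_rw [integral_const_mul, key]
      simp
    · intro j hj
      refine Integrable.const_mul (Integrable.of_bound (C := K * (B + B)) ?_
        (Eventually.of_forall fun ω => ?_)) _
      · exact ((hg.mono (F.le t) le_rfl).mul (((hΨ1 t j hj).mono (F.le _) le_rfl).sub
          ((hI t).mono (F.le t) le_rfl))).aestronglyMeasurable
      · rw [Real.norm_eq_abs, abs_mul]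
        exact mul_le_mul (hK _) ((abs_sub _ _).trans (add_le_add (hB _ _ _) (hIb _ _)))
          (abs_nonneg _) ((abs_nonneg _).trans (hK ω))

end Noise

/-! ### Deterministic properties of the iterates -/

section Iterates

variable {X : Type*} {C : X → X → ℝ} {n : ℕ} {η : ℕ → ℝ}

theorem uIter_zero (C : X → X → ℝ) (n : ℕ) (η : ℕ → ℝ) (x y : ℕ → X) (z : X) :
    uIter C n η x y 0 z = ∑ i ∈ Finset.range n, Real.exp (-C z (y i)) := by
  simp [uIter, kernelSum, weights]

theorem vIter_zero (C : X → X → ℝ) (n : ℕ) (η : ℕ → ℝ) (x y : ℕ → X) (z : X) :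
    vIter C n η x y 0 z = ∑ i ∈ Finset.range n, Real.exp (-C (x i) z) := by
  simp [vIter, kernelSum, weights]

theorem uIter_swap_and_vIter_swap (C : X → X → ℝ) (n : ℕ) (η : ℕ → ℝ) (x y : ℕ → X) (t : ℕ) :
    (∀ z, uIter (fun a b => C b a) n η y x t z = vIter C n η x y t z) ∧
      ∀ z, vIter (fun a b => C b a) n η y x t z = uIter C n η x y t z := by
  induction t with
  | zero => exact ⟨fun z => by rw [uIter_zero, vIter_zero], fun z => by rw [uIter_zero, vIter_zero]⟩
  | succ t ih =>
    refine ⟨fun z => ?_, fun z => ?_⟩ <;> rw [uIter_succ, vIter_succ] <;> simp only [ih.1, ih.2]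

theorem vIter_eq_uIter_swap (C : X → X → ℝ) (n : ℕ) (η : ℕ → ℝ) (x y : ℕ → X) (t : ℕ) (z : X) :
    vIter C n η x y t z = uIter (fun a b => C b a) n η y x t z :=
  ((uIter_swap_and_vIter_swap C n η x y t).1 z).symm

theorem uIter_pos_and_vIter_pos (hn : 0 < n) (hη : ∀ t, 0 ≤ η t) (hη1 : ∀ t, η t ≤ 1)
    (x y : ℕ → X) (t : ℕ) :
    (∀ z, 0 < uIter C n η x y t z) ∧ ∀ z, 0 < vIter C n η x y t z := by
  have hne : (Finset.range n).Nonempty := Finset.nonempty_range_iff.2 hn.ne'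
  have hn' : (0 : ℝ) < 1 / n := by positivity
  have key : ∀ {c e a b : ℝ}, 0 ≤ e → e ≤ 1 → 0 < a → 0 < b → 0 < c →
      0 < (1 - e) * a + e * (c * b) := by
    intro c e a b h0 h1 ha hb hc
    rcases h0.eq_or_lt with rfl | h0
    · simpa using ha
    · have := mul_nonneg (sub_nonneg.2 h1) ha.le
      positivity
  induction t with
  | zero =>
    refine ⟨fun z => ?_, fun z => ?_⟩
    · rw [uIter_zero]
      exact Finset.sum_pos (fun _ _ => Real.exp_pos _) hne
    · rw [vIter_zero]
      exact Finset.sum_pos (fun _ _ => Real.exp_pos _) hne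
  | succ t ih =>
    refine ⟨fun z => ?_, fun z => ?_⟩
    · rw [uIter_succ]
      refine key (hη t) (hη1 t) (ih.1 z) (Finset.sum_pos (fun j _ => ?_) hne) hn'
      have := ih.2 (y ((t + 1) * n + j))
      positivity
    · rw [vIter_succ]
      refine key (hη t) (hη1 t) (ih.2 z) (Finset.sum_pos (fun j _ => ?_) hne) hn'
      have := ih.1 (x ((t + 1) * n + j))
      positivity

theorem uIter_pos (hn : 0 < n) (hη : ∀ t, 0 ≤ η t) (hη1 : ∀ t, η t ≤ 1) (x y : ℕ → X) (t : ℕ)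
    (z : X) : 0 < uIter C n η x y t z :=
  (uIter_pos_and_vIter_pos hn hη hη1 x y t).1 z

theorem vIter_pos (hn : 0 < n) (hη : ∀ t, 0 ≤ η t) (hη1 : ∀ t, η t ≤ 1) (x y : ℕ → X) (t : ℕ)
    (z : X) : 0 < vIter C n η x y t z :=
  (uIter_pos_and_vIter_pos hn hη hη1 x y t).2 z

/-- The iterates inherit every Harnack-type inequality of the kernel. -/
theorem uIter_le_mul (hn : 0 < n) (hη : ∀ t, 0 ≤ η t) (hη1 : ∀ t, η t ≤ 1) {z z' : X} {K : ℝ}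
    (hK : ∀ y, Real.exp (-C z y) ≤ K * Real.exp (-C z' y)) (x y : ℕ → X) (t : ℕ) :
    uIter C n η x y t z ≤ K * uIter C n η x y t z' := by
  induction t with
  | zero =>
    rw [uIter_zero, uIter_zero, Finset.mul_sum]
    exact Finset.sum_le_sum fun i _ => hK _
  | succ t ih =>
    rw [uIter_succ, uIter_succ, mul_add]
    refine add_le_add ?_ ?_
    · rw [mul_left_comm]
      exact mul_le_mul_of_nonneg_left ih (sub_nonneg.2 (hη1 t))
    · rw [mul_left_comm K (η t), mul_left_comm K (1 / (n : ℝ)), Finset.mul_sum (a := K)]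
      refine mul_le_mul_of_nonneg_left (mul_le_mul_of_nonneg_left
        (Finset.sum_le_sum fun j _ => ?_) (one_div_nonneg.2 n.cast_nonneg)) (hη t)
      rw [mul_left_comm]
      exact mul_le_mul_of_nonneg_left (hK _)
        (one_div_nonneg.2 (vIter_pos hn hη hη1 x y t _).le)

theorem vIter_le_mul (hn : 0 < n) (hη : ∀ t, 0 ≤ η t) (hη1 : ∀ t, η t ≤ 1) {z z' : X} {K : ℝ}
    (hK : ∀ x, Real.exp (-C x z) ≤ K * Real.exp (-C x z')) (x y : ℕ → X) (t : ℕ) :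
    vIter C n η x y t z ≤ K * vIter C n η x y t z' := by
  rw [vIter_eq_uIter_swap, vIter_eq_uIter_swap]
  exact uIter_le_mul hn hη hη1 hK y x t

/-- Coupling density of the current potentials with respect to `α ⊗ β`:
`exp (f_t(a) + g_t(b) - C(a, b))`. -/
noncomputable def planDensity (C : X → X → ℝ) (n : ℕ) (η : ℕ → ℝ) (x y : ℕ → X) (t : ℕ) (a b : X) : ℝ :=
  Real.exp (-C a b) / (uIter C n η x y t a * vIter C n η x y t b)

theorem planDensity_swap (C : X → X → ℝ) (n : ℕ) (η : ℕ → ℝ) (x y : ℕ → X) (t : ℕ) (a b : X) :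
    planDensity (fun a b => C b a) n η y x t b a = planDensity C n η x y t a b := by
  rw [planDensity, planDensity, (uIter_swap_and_vIter_swap C n η x y t).1,
    (uIter_swap_and_vIter_swap C n η x y t).2, mul_comm]

theorem uIter_succ_eq_mul (hn : 0 < n) (hη : ∀ t, 0 ≤ η t) (hη1 : ∀ t, η t ≤ 1) (x y : ℕ → X)
    (t : ℕ) (z : X) :
    uIter C n η x y (t + 1) z = uIter C n η x y t z * (1 + η t * ((1 / n) *
      ∑ j ∈ Finset.range n, planDensity C n η x y t z (y ((t + 1) * n + j)) - 1)) := by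
  have hu := (uIter_pos (C := C) hn hη hη1 x y t z).ne'
  have e : ∀ j, 1 / vIter C n η x y t (y ((t + 1) * n + j)) *
        Real.exp (-C z (y ((t + 1) * n + j)))
      = uIter C n η x y t z * planDensity C n η x y t z (y ((t + 1) * n + j)) := fun j => by
    have hv := (vIter_pos (C := C) hn hη hη1 x y t (y ((t + 1) * n + j))).ne'
    rw [planDensity]
    field_simp
  rw [uIter_succ]
  simp_rw [e]
  rw [← Finset.mul_sum]
  ring

/-- The smallest growth factor in the scalar step `u ↦ (1 - e) u + e A`, `A ≥ κ / v`. -/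
theorem step_ge_mul {u v κ e A r : ℝ} (hu : 0 < u) (hv : 0 < v) (he : 0 ≤ e) (he1 : e ≤ 1)
    (hA : κ / v ≤ A) (hr1 : r ≤ 1) (hr : r * (u * v) ≤ κ) : r * u ≤ (1 - e) * u + e * A := by
  have h1 : r * u ≤ A := by
    refine le_trans ?_ hA
    rw [le_div_iff₀ hv]
    linarith
  nlinarith [mul_le_mul_of_nonneg_right hr1 hu.le]

theorem step_le_mul {u v K e A r : ℝ} (hu : 0 < u) (hv : 0 < v) (he : 0 ≤ e) (he1 : e ≤ 1)
    (hA : A ≤ K / v) (hr1 : 1 ≤ r) (hr : K ≤ r * (u * v)) : (1 - e) * u + e * A ≤ r * u := by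
  have h1 : A ≤ r * u := by
    refine hA.trans ?_
    rw [div_le_iff₀ hv]
    linarith
  nlinarith [mul_le_mul_of_nonneg_right hr1 hu.le]

theorem product_step_ge {u v κ e A A' r : ℝ} (hu : 0 < u) (hv : 0 < v) (he : 0 ≤ e) (he1 : e ≤ 1)
    (hA : κ / v ≤ A) (hA' : κ / u ≤ A') (hr0 : 0 ≤ r) (hr1 : r ≤ 1) (hr : r * (u * v) ≤ κ) :
    r ^ 2 * (u * v) ≤ ((1 - e) * u + e * A) * ((1 - e) * v + e * A') := by
  have h1 := step_ge_mul hu hv he he1 hA hr1 hr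
  have h2 := step_ge_mul hv hu he he1 hA' hr1 (by rwa [mul_comm v u])
  calc r ^ 2 * (u * v) = (r * u) * (r * v) := by ring
    _ ≤ _ := mul_le_mul h1 h2 (by positivity) ((by positivity : 0 ≤ r * u).trans h1)

theorem product_step_le {u v K e A A' r : ℝ} (hu : 0 < u) (hv : 0 < v) (he : 0 ≤ e) (he1 : e ≤ 1)
    (hA : A ≤ K / v) (hA' : A' ≤ K / u) (hA0 : 0 ≤ A') (hr1 : 1 ≤ r) (hr : K ≤ r * (u * v)) :
    ((1 - e) * u + e * A) * ((1 - e) * v + e * A') ≤ r ^ 2 * (u * v) := by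
  have h1 := step_le_mul hu hv he he1 hA hr1 hr
  have h2 := step_le_mul hv hu he he1 hA' hr1 (by rwa [mul_comm v u])
  have h3 : 0 ≤ (1 - e) * v + e * A' := by
    have := mul_nonneg (sub_nonneg.2 he1) hv.le
    positivity
  calc _ ≤ (r * u) * (r * v) := mul_le_mul h1 h2 h3 (by positivity)
    _ = r ^ 2 * (u * v) := by ring

theorem batch_bounds (hn : 0 < n) (hη : ∀ t, 0 ≤ η t) (hη1 : ∀ t, η t ≤ 1) {B : ℝ}
    (hB : ∀ a b, |C a b| ≤ B) (x y : ℕ → X) (t : ℕ) (z z' : X) :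
    Real.exp (-(3 * B)) / vIter C n η x y t z' ≤ (1 / n) * ∑ j ∈ Finset.range n,
        1 / vIter C n η x y t (y ((t + 1) * n + j)) * Real.exp (-C z (y ((t + 1) * n + j))) ∧
    (1 / n) * ∑ j ∈ Finset.range n,
        1 / vIter C n η x y t (y ((t + 1) * n + j)) * Real.exp (-C z (y ((t + 1) * n + j))) ≤
      Real.exp (3 * B) / vIter C n η x y t z' := by
  have hv := vIter_pos (C := C) hn hη hη1 x y t
  have hn' : (0 : ℝ) < n := Nat.cast_pos.2 hn
  have hr : ∀ b b', vIter C n η x y t b ≤ Real.exp (2 * B) * vIter C n η x y t b' :=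
    fun b b' => vIter_le_mul hn hη hη1 (fun a => by
      rw [← Real.exp_add]
      refine Real.exp_le_exp.2 ?_
      linarith [neg_abs_le (C a b), hB a b, le_abs_self (C a b'), hB a b']) x y t
  have e3 : Real.exp (3 * B) = Real.exp (2 * B) * Real.exp B := by
    rw [← Real.exp_add]
    ring_nf
  have hlo : ∀ b, Real.exp (-(3 * B)) / vIter C n η x y t z'
      ≤ 1 / vIter C n η x y t b * Real.exp (-C z b) := fun b => by
    have h2 : Real.exp (-B) ≤ Real.exp (-C z b) :=
      Real.exp_le_exp.2 (neg_le_neg ((le_abs_self _).trans (hB z b)))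
    have h3 := hr b z'
    rw [Real.exp_neg, e3, one_div_mul_eq_div, div_le_div_iff₀ (hv _) (hv _)]
    calc (Real.exp (2 * B) * Real.exp B)⁻¹ * vIter C n η x y t b
        ≤ (Real.exp (2 * B) * Real.exp B)⁻¹ * (Real.exp (2 * B) * vIter C n η x y t z') := by
          gcongr
      _ = Real.exp (-B) * vIter C n η x y t z' := by
          rw [Real.exp_neg]
          field_simp
      _ ≤ _ := mul_le_mul_of_nonneg_right h2 (hv z').le
  have hhi : ∀ b, 1 / vIter C n η x y t b * Real.exp (-C z b)
      ≤ Real.exp (3 * B) / vIter C n η x y t z' := fun b => by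
    have h2 : Real.exp (-C z b) ≤ Real.exp B :=
      Real.exp_le_exp.2 ((neg_le_abs _).trans (hB z b))
    rw [e3, one_div_mul_eq_div, div_le_div_iff₀ (hv _) (hv _)]
    calc Real.exp (-C z b) * vIter C n η x y t z'
        ≤ Real.exp B * (Real.exp (2 * B) * vIter C n η x y t b) :=
          mul_le_mul h2 (hr z' b) (hv z').le (Real.exp_pos _).le
      _ = _ := by ring
  constructor
  · have := Finset.card_nsmul_le_sum (Finset.range n) (fun j =>
      1 / vIter C n η x y t (y ((t + 1) * n + j)) * Real.exp (-C z (y ((t + 1) * n + j)))) _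
      fun j _ => hlo (y ((t + 1) * n + j))
    rw [Finset.card_range, nsmul_eq_mul] at this
    rw [one_div_mul_eq_div, le_div_iff₀ hn']
    linarith
  · have := Finset.sum_le_card_nsmul (Finset.range n) (fun j =>
      1 / vIter C n η x y t (y ((t + 1) * n + j)) * Real.exp (-C z (y ((t + 1) * n + j)))) _
      fun j _ => hhi (y ((t + 1) * n + j))
    rw [Finset.card_range, nsmul_eq_mul] at this
    rw [one_div_mul_eq_div, div_le_iff₀ hn']
    linarith

theorem batch_bounds' (hn : 0 < n) (hη : ∀ t, 0 ≤ η t) (hη1 : ∀ t, η t ≤ 1) {B : ℝ}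
    (hB : ∀ a b, |C a b| ≤ B) (x y : ℕ → X) (t : ℕ) (z z' : X) :
    Real.exp (-(3 * B)) / uIter C n η x y t z' ≤ (1 / n) * ∑ j ∈ Finset.range n,
        1 / uIter C n η x y t (x ((t + 1) * n + j)) * Real.exp (-C (x ((t + 1) * n + j)) z) ∧
    (1 / n) * ∑ j ∈ Finset.range n,
        1 / uIter C n η x y t (x ((t + 1) * n + j)) * Real.exp (-C (x ((t + 1) * n + j)) z) ≤
      Real.exp (3 * B) / uIter C n η x y t z' := by
  simpa only [(uIter_swap_and_vIter_swap C n η x y t).2] using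
    batch_bounds (C := fun a b => C b a) hn hη hη1 (fun a b => hB b a) y x t z z'

/-- The products `u_t(a) v_t(b)` stay in a compact subset of `(0, ∞)`, uniformly over all sample
sequences. -/
theorem exists_bounds_uIter_mul_vIter (hn : 0 < n) (hη : IsRobbinsMonro η) {B : ℝ}
    (hB : ∀ a b, |C a b| ≤ B) :
    ∃ lo hi : ℝ, 0 < lo ∧ ∀ (x y : ℕ → X) (t : ℕ) (a b : X),
      lo ≤ uIter C n η x y t a * vIter C n η x y t b ∧
        uIter C n η x y t a * vIter C n η x y t b ≤ hi := by
  have hu := uIter_pos (C := C) hn hη.nonneg hη.le_one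
  have hv := vIter_pos (C := C) hn hη.nonneg hη.le_one
  set κ := Real.exp (-(3 * B)) with hκ
  set K := Real.exp (3 * B) with hK
  have hκ0 : 0 < κ := Real.exp_pos _
  have hK0 : 0 < K := Real.exp_pos _
  have hge : ∀ (x y : ℕ → X) (t : ℕ) (a b : X) (r : ℝ), 0 ≤ r → r ≤ 1 →
      r * (uIter C n η x y t a * vIter C n η x y t b) ≤ κ →
      r ^ 2 * (uIter C n η x y t a * vIter C n η x y t b) ≤
        uIter C n η x y (t + 1) a * vIter C n η x y (t + 1) b := by
    intro x y t a b r hr0 hr1 hr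
    rw [uIter_succ, vIter_succ]
    exact product_step_ge (hu x y t a) (hv x y t b) (hη.nonneg t) (hη.le_one t)
      (batch_bounds hn hη.nonneg hη.le_one hB x y t a b).1
      (batch_bounds' hn hη.nonneg hη.le_one hB x y t b a).1 hr0 hr1 hr
  have hle : ∀ (x y : ℕ → X) (t : ℕ) (a b : X) (r : ℝ), 1 ≤ r →
      K ≤ r * (uIter C n η x y t a * vIter C n η x y t b) →
      uIter C n η x y (t + 1) a * vIter C n η x y (t + 1) b ≤
        r ^ 2 * (uIter C n η x y t a * vIter C n η x y t b) := by
    intro x y t a b r hr1 hr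
    have h1 := batch_bounds' hn hη.nonneg hη.le_one hB x y t b a
    rw [uIter_succ, vIter_succ]
    exact product_step_le (hu x y t a) (hv x y t b) (hη.nonneg t) (hη.le_one t)
      (batch_bounds hn hη.nonneg hη.le_one hB x y t a b).2 h1.2
      ((div_pos hκ0 (hu x y t a)).le.trans h1.1) hr1 hr
  have hfin : ∀ T : ℕ, ∃ lo hi : ℝ, 0 < lo ∧ ∀ (x y : ℕ → X), ∀ t ≤ T, ∀ (a b : X),
      lo ≤ uIter C n η x y t a * vIter C n η x y t b ∧
        uIter C n η x y t a * vIter C n η x y t b ≤ hi := by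
    intro T
    induction T with
    | zero =>
      have hn' : (0 : ℝ) < n := Nat.cast_pos.2 hn
      have h1 : ∀ c : ℕ → ℝ, (∀ i, |c i| ≤ B) →
          n * Real.exp (-B) ≤ ∑ i ∈ Finset.range n, Real.exp (-c i) ∧
          ∑ i ∈ Finset.range n, Real.exp (-c i) ≤ n * Real.exp B := by
        intro c hc
        constructor
        · have := Finset.card_nsmul_le_sum (Finset.range n) (fun i => Real.exp (-c i))
            (Real.exp (-B)) fun i _ =>
              Real.exp_le_exp.2 (neg_le_neg ((le_abs_self _).trans (hc i)))
          rwa [Finset.card_range, nsmul_eq_mul] at this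
        · have := Finset.sum_le_card_nsmul (Finset.range n) (fun i => Real.exp (-c i))
            (Real.exp B) fun i _ => Real.exp_le_exp.2 ((neg_le_abs _).trans (hc i))
          rwa [Finset.card_range, nsmul_eq_mul] at this
      refine ⟨n * Real.exp (-B) * (n * Real.exp (-B)), n * Real.exp B * (n * Real.exp B),
        by positivity, fun x y t ht a b => ?_⟩
      obtain rfl : t = 0 := Nat.le_zero.1 ht
      obtain ⟨h2, h3⟩ := h1 (fun i => C a (y i)) fun i => hB _ _
      obtain ⟨h4, h5⟩ := h1 (fun i => C (x i) b) fun i => hB _ _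
      rw [uIter_zero, vIter_zero]
      have h0 : (0 : ℝ) ≤ n * Real.exp (-B) := by positivity
      exact ⟨mul_le_mul h2 h4 h0 (h0.trans h2),
        mul_le_mul h3 h5 (h0.trans h4) (by positivity)⟩
    | succ T ih =>
      obtain ⟨lo, hi, hlo, h⟩ := ih
      set r := min 1 (κ / max hi 1) with hr
      have hm : 0 < max hi 1 := lt_of_lt_of_le one_pos (le_max_right _ _)
      have hr0 : 0 < r := lt_min one_pos (by positivity)
      set R := max 1 (K / lo) with hR
      refine ⟨min lo (r ^ 2 * lo), max hi (R ^ 2 * hi), by positivity, fun x y t ht a b => ?_⟩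
      rcases ht.lt_or_eq with h1 | rfl
      · have := h x y t (Nat.lt_succ_iff.1 h1) a b
        exact ⟨(min_le_left _ _).trans this.1, this.2.trans (le_max_left _ _)⟩
      · obtain ⟨h1, h2⟩ := h x y T le_rfl a b
        constructor
        · refine (min_le_right _ _).trans ((mul_le_mul_of_nonneg_left h1 (sq_nonneg r)).trans
            (hge x y T a b r hr0.le (min_le_left _ _) ?_))
          calc r * (uIter C n η x y T a * vIter C n η x y T b)
              ≤ κ / max hi 1 * max hi 1 :=
                mul_le_mul (min_le_right _ _) (h2.trans (le_max_left _ _))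
                  (hlo.le.trans h1) (by positivity)
            _ = κ := div_mul_cancel₀ _ hm.ne'
        · refine le_trans (hle x y T a b R (le_max_left _ _) ?_)
            ((mul_le_mul_of_nonneg_left h2 (sq_nonneg R)).trans (le_max_right _ _))
          calc K = K / lo * lo := (div_mul_cancel₀ _ hlo.ne').symm
            _ ≤ R * _ := mul_le_mul (le_max_right _ _) h1 hlo.le
                (zero_le_one.trans (le_max_left _ _))
  obtain ⟨T, hT⟩ := eventually_atTop.1 (hη.tendsto_zero.eventually
    (gt_mem_nhds (by norm_num : (0 : ℝ) < 1 / 2)))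
  obtain ⟨lo₀, hi₀, hlo₀, h₀⟩ := hfin T
  set lo := min lo₀ (κ / 4) with hlo
  have hlop : 0 < lo := lt_min hlo₀ (by positivity)
  set hi := max hi₀ (4 * K ^ 2 / lo) with hhi
  refine ⟨lo, hi, hlop, fun x y t a b => ?_⟩
  rcases le_total t T with ht | ht
  · have := h₀ x y t ht a b
    exact ⟨(min_le_left _ _).trans this.1, this.2.trans (le_max_left _ _)⟩
  induction t, ht using Nat.le_induction with
  | base =>
    have := h₀ x y T le_rfl a b
    exact ⟨(min_le_left _ _).trans this.1, this.2.trans (le_max_left _ _)⟩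
  | succ t ht ih =>
    obtain ⟨h1, h2⟩ := ih
    have hup := hu x y t a
    have hvp := hv x y t b
    have hp : 0 < uIter C n η x y t a * vIter C n η x y t b := mul_pos hup hvp
    have hηt := hT t ht
    have hb := batch_bounds' hn hη.nonneg hη.le_one hB x y t b a
    have hb' := batch_bounds hn hη.nonneg hη.le_one hB x y t a b
    constructor
    · rcases le_total (uIter C n η x y t a * vIter C n η x y t b) κ with hc | hc
      · have := hge x y t a b 1 zero_le_one le_rfl (by rwa [one_mul])
        rw [one_pow, one_mul] at this
        exact h1.trans this
      · refine (min_le_right _ _).trans ?_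
        rw [uIter_succ, vIter_succ]
        have e1 : uIter C n η x y t a / 2 ≤ (1 - η t) * uIter C n η x y t a + η t * ((1 / n) *
            ∑ j ∈ Finset.range n, 1 / vIter C n η x y t (y ((t + 1) * n + j)) *
              Real.exp (-C a (y ((t + 1) * n + j)))) := by
          have := mul_nonneg (hη.nonneg t) ((div_pos hκ0 hvp).le.trans hb'.1)
          nlinarith
        have e2 : vIter C n η x y t b / 2 ≤ (1 - η t) * vIter C n η x y t b + η t * ((1 / n) *
            ∑ j ∈ Finset.range n, 1 / uIter C n η x y t (x ((t + 1) * n + j)) *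
              Real.exp (-C (x ((t + 1) * n + j)) b)) := by
          have := mul_nonneg (hη.nonneg t) ((div_pos hκ0 hup).le.trans hb.1)
          nlinarith
        refine le_trans ?_ (mul_le_mul e1 e2 (by positivity) ((half_pos hup).le.trans e1))
        linarith
    · rcases le_total K (uIter C n η x y t a * vIter C n η x y t b) with hc | hc
      · have := hle x y t a b 1 le_rfl (by rwa [one_mul])
        rw [one_pow, one_mul] at this
        exact this.trans h2
      · set p := uIter C n η x y t a * vIter C n η x y t b with hpdef
        refine (hle x y t a b (1 + K / p) (by
          have : 0 ≤ K / p := by positivity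
          linarith) ?_).trans (le_trans ?_ (le_max_right _ _))
        · rw [← hpdef, add_mul, div_mul_cancel₀ _ hp.ne']
          linarith
        · rw [← hpdef]
          have e1 : (1 + K / p) ^ 2 * p = (p + K) ^ 2 / p := by field_simp
          rw [e1]
          calc (p + K) ^ 2 / p ≤ (2 * K) ^ 2 / lo := by
                gcongr
                linarith
            _ = 4 * K ^ 2 / lo := by ring

end Iterates

/-! ### Regularity of the iterates -/

section Regularity

variable {X : Type*} {C : X → X → ℝ} {n : ℕ} {η : ℕ → ℝ}

theorem continuous_uIter [TopologicalSpace X] (hC : Continuous fun p : X × X => C p.1 p.2)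
    (n : ℕ) (η : ℕ → ℝ) (x y : ℕ → X) (t : ℕ) : Continuous (uIter C n η x y t) := by
  refine continuous_finsetSum (Finset.range ((t + 1) * n)) fun i _ => continuous_const.mul ?_
  exact Real.continuous_exp.comp
    (hC.comp (continuous_id.prodMk continuous_const : Continuous fun z : X => (z, y i))).neg

theorem continuous_vIter [TopologicalSpace X] (hC : Continuous fun p : X × X => C p.1 p.2)
    (n : ℕ) (η : ℕ → ℝ) (x y : ℕ → X) (t : ℕ) : Continuous (vIter C n η x y t) := by
  rw [funext (vIter_eq_uIter_swap C n η x y t)]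
  exact continuous_uIter (C := fun a b => C b a) (hC.comp continuous_swap) n η y x t

theorem continuous_planDensity [TopologicalSpace X] (hC : Continuous fun p : X × X => C p.1 p.2)
    (hn : 0 < n) (hη : ∀ t, 0 ≤ η t) (hη1 : ∀ t, η t ≤ 1) (x y : ℕ → X) (t : ℕ) :
    Continuous fun p : X × X => planDensity C n η x y t p.1 p.2 := by
  refine (Real.continuous_exp.comp hC.neg).div
    (((continuous_uIter hC n η x y t).comp continuous_fst).mul
      ((continuous_vIter hC n η x y t).comp continuous_snd)) fun p => ?_
  exact (mul_pos (uIter_pos hn hη hη1 x y t _) (vIter_pos hn hη hη1 x y t _)).ne'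

theorem measurable_uIter_and_vIter [MeasurableSpace X]
    (hC : Measurable fun p : X × X => C p.1 p.2) {S : Type*} [MeasurableSpace S]
    {x y : ℕ → S → X} {t : ℕ} (hx : ∀ i < (t + 1) * n, Measurable (x i))
    (hy : ∀ i < (t + 1) * n, Measurable (y i)) :
    (Measurable fun p : S × X => uIter C n η (fun i => x i p.1) (fun i => y i p.1) t p.2) ∧
      Measurable fun p : S × X => vIter C n η (fun i => x i p.1) (fun i => y i p.1) t p.2 := by
  induction t with
  | zero =>
    simp only [uIter_zero, vIter_zero]
    constructor
    · refine Finset.measurable_fun_sum _ fun i hi => Real.measurable_exp.comp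
        (hC.comp (measurable_snd.prodMk ((hy i ?_).comp measurable_fst))).neg
      simpa using hi
    · refine Finset.measurable_fun_sum _ fun i hi => Real.measurable_exp.comp
        (hC.comp (((hx i ?_).comp measurable_fst).prodMk measurable_snd)).neg
      simpa using hi
  | succ t ih =>
    have hlt : ∀ i < (t + 1) * n, i < (t + 1 + 1) * n := fun i hi =>
      hi.trans_le (Nat.mul_le_mul_right n (Nat.le_succ _))
    obtain ⟨hu, hv⟩ := ih (fun i hi => hx i (hlt i hi)) fun i hi => hy i (hlt i hi)
    have hj : ∀ j ∈ Finset.range n, (t + 1) * n + j < (t + 1 + 1) * n := fun j hj => by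
      rw [Nat.add_mul (t + 1) 1 n, one_mul]
      exact Nat.add_lt_add_left (Finset.mem_range.1 hj) _
    simp only [uIter_succ, vIter_succ]
    constructor
    · refine (hu.const_mul _).add ((Measurable.const_mul (Finset.measurable_fun_sum _
        fun j hjn => ?_) _).const_mul _)
      have h1 : Measurable fun p : S × X => y ((t + 1) * n + j) p.1 :=
        (hy _ (hj j hjn)).comp measurable_fst
      exact (measurable_const.div (hv.comp (measurable_fst.prodMk h1))).mul
        (Real.measurable_exp.comp (hC.comp (measurable_snd.prodMk h1)).neg)
    · refine (hv.const_mul _).add ((Measurable.const_mul (Finset.measurable_fun_sum _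
        fun j hjn => ?_) _).const_mul _)
      have h1 : Measurable fun p : S × X => x ((t + 1) * n + j) p.1 :=
        (hx _ (hj j hjn)).comp measurable_fst
      exact (measurable_const.div (hu.comp (measurable_fst.prodMk h1))).mul
        (Real.measurable_exp.comp (hC.comp (h1.prodMk measurable_snd)).neg)

theorem measurable_planDensity [MeasurableSpace X]
    (hC : Measurable fun p : X × X => C p.1 p.2) {S : Type*} [MeasurableSpace S]
    {x y : ℕ → S → X} {t : ℕ} (hx : ∀ i < (t + 1) * n, Measurable (x i))
    (hy : ∀ i < (t + 1) * n, Measurable (y i)) :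
    Measurable fun p : S × X × X =>
      planDensity C n η (fun i => x i p.1) (fun i => y i p.1) t p.2.1 p.2.2 := by
  obtain ⟨hu, hv⟩ := measurable_uIter_and_vIter (η := η) hC hx hy
  have h1 : Measurable fun p : S × X × X => (p.1, p.2.1) := by fun_prop
  have h2 : Measurable fun p : S × X × X => (p.1, p.2.2) := by fun_prop
  exact (Real.measurable_exp.comp (hC.comp measurable_snd).neg).div
    ((hu.comp h1).mul (hv.comp h2))

theorem measurable_planDensity_right [MeasurableSpace X]
    (hC : Measurable fun p : X × X => C p.1 p.2) {S : Type*} {mS : MeasurableSpace S} {x y : ℕ → S → X} {t : ℕ}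
    (hx : ∀ i < (t + 1) * n, Measurable (x i)) (hy : ∀ i < (t + 1) * n, Measurable (y i)) (z : X) :
    Measurable fun p : S × X =>
      planDensity C n η (fun i => x i p.1) (fun i => y i p.1) t z p.2 :=
  (measurable_planDensity (η := η) hC hx hy).comp
    (by fun_prop : Measurable fun p : S × X => (p.1, z, p.2))

theorem exists_bounds_planDensity (hn : 0 < n) (hη : IsRobbinsMonro η) {B : ℝ}
    (hB : ∀ a b, |C a b| ≤ B) :
    ∃ lo hi : ℝ, 0 < lo ∧ ∀ (x y : ℕ → X) (t : ℕ) (a b : X),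
      lo ≤ planDensity C n η x y t a b ∧ planDensity C n η x y t a b ≤ hi := by
  obtain ⟨lo, hi, hlo, h⟩ := exists_bounds_uIter_mul_vIter (C := C) hn hη hB
  rcases isEmpty_or_nonempty X with hX | ⟨⟨a₀⟩⟩
  · exact ⟨1, 1, one_pos, fun x => isEmptyElim (x 0)⟩
  have hhi : 0 < hi := by
    have := h (fun _ => a₀) (fun _ => a₀) 0 a₀ a₀
    linarith
  refine ⟨Real.exp (-B) / hi, Real.exp B / lo, by positivity, fun x y t a b => ?_⟩
  obtain ⟨h1, h2⟩ := h x y t a b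
  have h3 : Real.exp (-B) ≤ Real.exp (-C a b) :=
    Real.exp_le_exp.2 (neg_le_neg ((le_abs_self _).trans (hB a b)))
  have h4 : Real.exp (-C a b) ≤ Real.exp B := Real.exp_le_exp.2 ((neg_le_abs _).trans (hB a b))
  have h5 := hlo.trans_le h1
  unfold planDensity
  constructor <;> gcongr

theorem fIter_succ (hn : 0 < n) (hη : ∀ t, 0 ≤ η t) (hη1 : ∀ t, η t ≤ 1) (x y : ℕ → X)
    (t : ℕ) (z : X) :
    fIter C n η x y (t + 1) z = fIter C n η x y t z - Real.log (1 + η t * ((1 / n) *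
      ∑ j ∈ Finset.range n, planDensity C n η x y t z (y ((t + 1) * n + j)) - 1)) := by
  have h1 := uIter_pos (C := C) hn hη hη1 x y (t + 1) z
  have h0 := uIter_pos (C := C) hn hη hη1 x y t z
  have e := uIter_succ_eq_mul (C := C) hn hη hη1 x y t z
  rw [e] at h1
  rw [fIter, fIter, e, Real.log_mul h0.ne' (pos_of_mul_pos_right h1 h0.le).ne']
  ring

theorem gIter_eq_fIter_swap (C : X → X → ℝ) (n : ℕ) (η : ℕ → ℝ) (x y : ℕ → X) (t : ℕ) (z : X) :
    gIter C n η x y t z = fIter (fun a b => C b a) n η y x t z := by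
  rw [gIter, fIter, vIter_eq_uIter_swap]

theorem gIter_succ (hn : 0 < n) (hη : ∀ t, 0 ≤ η t) (hη1 : ∀ t, η t ≤ 1) (x y : ℕ → X)
    (t : ℕ) (z : X) :
    gIter C n η x y (t + 1) z = gIter C n η x y t z - Real.log (1 + η t * ((1 / n) *
      ∑ j ∈ Finset.range n, planDensity C n η x y t (x ((t + 1) * n + j)) z - 1)) := by
  rw [gIter_eq_fIter_swap, gIter_eq_fIter_swap, fIter_succ hn hη hη1]
  simp only [planDensity_swap]

theorem planDensity_eq_exp (hn : 0 < n) (hη : ∀ t, 0 ≤ η t) (hη1 : ∀ t, η t ≤ 1) (x y : ℕ → X)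
    (t : ℕ) (a b : X) : planDensity C n η x y t a b =
      Real.exp (fIter C n η x y t a + gIter C n η x y t b - C a b) := by
  rw [fIter, gIter, planDensity, sub_eq_add_neg, Real.exp_add, Real.exp_add,
    Real.exp_neg (Real.log _), Real.exp_neg (Real.log _), Real.exp_log (uIter_pos hn hη hη1 x y t a),
    Real.exp_log (vIter_pos hn hη hη1 x y t b)]
  have := (uIter_pos (C := C) hn hη hη1 x y t a).ne'
  have := (vIter_pos (C := C) hn hη hη1 x y t b).ne'
  field_simp

theorem continuous_fIter [TopologicalSpace X] (hC : Continuous fun p : X × X => C p.1 p.2)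
    (hn : 0 < n) (hη : ∀ t, 0 ≤ η t) (hη1 : ∀ t, η t ≤ 1) (x y : ℕ → X) (t : ℕ) :
    Continuous (fIter C n η x y t) :=
  ((continuous_uIter hC n η x y t).log fun z => (uIter_pos hn hη hη1 x y t z).ne').neg

theorem continuous_gIter [TopologicalSpace X] (hC : Continuous fun p : X × X => C p.1 p.2)
    (hn : 0 < n) (hη : ∀ t, 0 ≤ η t) (hη1 : ∀ t, η t ≤ 1) (x y : ℕ → X) (t : ℕ) :
    Continuous (gIter C n η x y t) :=
  ((continuous_vIter hC n η x y t).log fun z => (vIter_pos hn hη hη1 x y t z).ne').neg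

theorem abs_fIter_sub_le [PseudoMetricSpace X] {L : ℝ≥0}
    (hC : LipschitzWith L fun p : X × X => C p.1 p.2) (hn : 0 < n) (hη : ∀ t, 0 ≤ η t)
    (hη1 : ∀ t, η t ≤ 1) (x y : ℕ → X) (t : ℕ) (z z' : X) :
    |fIter C n η x y t z - fIter C n η x y t z'| ≤ L * dist z z' := by
  have key : ∀ z z', fIter C n η x y t z' - fIter C n η x y t z ≤ L * dist z z' := by
    intro z z'
    have h := uIter_le_mul (C := C) (z := z) (z' := z') (K := Real.exp (L * dist z z'))
      hn hη hη1 (fun b => by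
        rw [← Real.exp_add]
        refine Real.exp_le_exp.2 ?_
        have := hC.dist_le_mul (z, b) (z', b)
        rw [Real.dist_eq, Prod.dist_eq] at this
        simp only [dist_self] at this
        rw [max_eq_left dist_nonneg] at this
        linarith [neg_abs_le (C z b - C z' b)]) x y t
    have h2 := Real.log_le_log (uIter_pos hn hη hη1 x y t z) h
    rw [Real.log_mul (Real.exp_pos _).ne' (uIter_pos hn hη hη1 x y t z').ne', Real.log_exp] at h2
    simp only [fIter]
    linarith
  rw [abs_le]
  constructor
  · linarith [key z z']
  · have := key z' z
    rwa [dist_comm] at this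

end Regularity

/-! ### The dual optimality gap -/

section Gap

variable {X : Type*} [MetricSpace X] [CompactSpace X] [MeasurableSpace X] [BorelSpace X]

theorem integrable_of_continuous_compact {Y : Type*} [TopologicalSpace Y] [CompactSpace Y]
    [MeasurableSpace Y] [OpensMeasurableSpace Y] {μ : Measure Y} [IsFiniteMeasure μ] {φ : Y → ℝ}
    (hφ : Continuous φ) : Integrable φ μ :=
  hφ.integrable_of_hasCompactSupport (HasCompactSupport.of_compactSpace _)

theorem sq_integral_abs_le {Y : Type*} [MeasurableSpace Y] {μ : Measure Y}
    [IsProbabilityMeasure μ] {h : Y → ℝ} (h1 : Integrable h μ)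
    (h2 : Integrable (fun y => h y ^ 2) μ) : (∫ y, |h y| ∂μ) ^ 2 ≤ ∫ y, h y ^ 2 ∂μ := by
  set c := ∫ y, |h y| ∂μ with hc
  have h3 : 0 ≤ ∫ y, (h y ^ 2 - 2 * c * |h y| + c ^ 2) ∂μ := integral_nonneg fun y => by
    have : h y ^ 2 - 2 * c * |h y| + c ^ 2 = (|h y| - c) ^ 2 := by
      rw [← sq_abs (h y)]
      ring
    simp only [this, Pi.zero_apply]
    positivity
  rw [integral_add (f := fun y => h y ^ 2 - 2 * c * |h y|) (h2.sub (h1.abs.const_mul _))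
      (integrable_const _),
    integral_sub h2 (h1.abs.const_mul _), integral_const_mul, ← hc] at h3
  simp at h3
  nlinarith

/-- The gap in the dual objective at `(f⋆ + φ, g⋆ + ψ)`, where `ρ` is the optimal coupling
density. -/
noncomputable def dualGap (ρ : X → X → ℝ) (α β : Measure X) (φ ψ : X → ℝ) : ℝ :=
  ∫ p : X × X, ρ p.1 p.2 * (Real.exp (φ p.1 + ψ p.2) - 1 - (φ p.1 + ψ p.2)) ∂(α.prod β)

/-- The defect in the first marginal of the coupling density `exp (φ + ψ) ρ`. -/
noncomputable def defect (ρ : X → X → ℝ) (β : Measure X) (φ ψ : X → ℝ) (a : X) : ℝ :=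
  ∫ b, Real.exp (φ a + ψ b) * ρ a b ∂β - 1

theorem dualGap_nonneg {X : Type*} [MeasurableSpace X] {ρ : X → X → ℝ} {α β : Measure X}
    {φ ψ : X → ℝ} (hρ0 : ∀ a b, 0 < ρ a b) : 0 ≤ dualGap ρ α β φ ψ :=
  integral_nonneg fun p => mul_nonneg (hρ0 _ _).le
    (by linarith [Real.add_one_le_exp (φ p.1 + ψ p.2)])

variable {ρ : X → X → ℝ} {α β : Measure X} [IsProbabilityMeasure α] [IsProbabilityMeasure β]
  {φ ψ : X → ℝ}

theorem continuous_integral_right {k : X → X → ℝ} (hk : Continuous fun p : X × X => k p.1 p.2) :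
    Continuous fun a => ∫ b, k a b ∂β := by
  have := continuous_parametric_integral_of_continuous (μ := β) (f := k) hk isCompact_univ
  simpa using this

theorem continuous_defect (hρ : Continuous fun p : X × X => ρ p.1 p.2) (hφ : Continuous φ)
    (hψ : Continuous ψ) : Continuous (defect ρ β φ ψ) :=
  (continuous_integral_right (k := fun a b => Real.exp (φ a + ψ b) * ρ a b)
    (by fun_prop)).sub continuous_const

theorem integral_fst_mul_defect (hρ : Continuous fun p : X × X => ρ p.1 p.2)
    (hρ1 : ∀ a, ∫ b, ρ a b ∂β = 1) (hφ : Continuous φ) (hψ : Continuous ψ) {F : X → ℝ}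
    (hF : Continuous F) :
    ∫ p : X × X, F p.1 * (ρ p.1 p.2 * (Real.exp (φ p.1 + ψ p.2) - 1)) ∂(α.prod β)
      = ∫ a, F a * defect ρ β φ ψ a ∂α := by
  rw [integral_prod _ (integrable_of_continuous_compact (by fun_prop))]
  refine integral_congr_ae (Eventually.of_forall fun a => ?_)
  have hρa : Continuous fun b => ρ a b := hρ.comp (continuous_const.prodMk continuous_id)
  have h1 : ∫ b, ρ a b * (Real.exp (φ a + ψ b) - 1) ∂β =
      ∫ b, Real.exp (φ a + ψ b) * ρ a b ∂β - ∫ b, ρ a b ∂β := by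
    rw [← integral_sub (integrable_of_continuous_compact (by fun_prop))
      (integrable_of_continuous_compact hρa)]
    refine integral_congr_ae (Eventually.of_forall fun b => ?_)
    ring
  simp only [defect]
  rw [integral_const_mul, h1, hρ1]

theorem integral_snd_mul_defect (hρ : Continuous fun p : X × X => ρ p.1 p.2)
    (hρ2 : ∀ b, ∫ a, ρ a b ∂α = 1) (hφ : Continuous φ) (hψ : Continuous ψ) {F : X → ℝ}
    (hF : Continuous F) :
    ∫ p : X × X, F p.2 * (ρ p.1 p.2 * (Real.exp (φ p.1 + ψ p.2) - 1)) ∂(α.prod β)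
      = ∫ b, F b * defect (fun b a => ρ a b) α ψ φ b ∂β := by
  rw [← integral_fst_mul_defect (ρ := fun b a => ρ a b) (α := β) (β := α)
    (hρ.comp continuous_swap) hρ2 hψ hφ hF, ← integral_prod_swap]
  simp only [Prod.fst_swap, Prod.snd_swap, add_comm]

theorem integral_density_eq_one (hρ : Continuous fun p : X × X => ρ p.1 p.2)
    (hρ1 : ∀ a, ∫ b, ρ a b ∂β = 1) : ∫ p : X × X, ρ p.1 p.2 ∂(α.prod β) = 1 := by
  rw [integral_prod _ (integrable_of_continuous_compact hρ)]
  simp [hρ1]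

/-- Second-order expansion of the dual gap. -/
theorem dualGap_add_le (hρ : Continuous fun p : X × X => ρ p.1 p.2) (hρ0 : ∀ a b, 0 < ρ a b)
    (hρ1 : ∀ a, ∫ b, ρ a b ∂β = 1) (hρ2 : ∀ b, ∫ a, ρ a b ∂α = 1) (hφ : Continuous φ)
    (hψ : Continuous ψ) {φ' ψ' : X → ℝ} (hφ' : Continuous φ') (hψ' : Continuous ψ') {S M δ : ℝ}
    (hS : ∀ a b, |φ a + ψ b| ≤ S) (hδ : ∀ a b, |φ' a + ψ' b| ≤ δ) (hδM : δ ≤ M) :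
    dualGap ρ α β (fun a => φ a + φ' a) (fun b => ψ b + ψ' b) ≤ dualGap ρ α β φ ψ +
      (∫ a, φ' a * defect ρ β φ ψ a ∂α + ∫ b, ψ' b * defect (fun b a => ρ a b) α ψ φ b ∂β) +
        Real.exp (S + M) * δ ^ 2 := by
  have h0 : Real.exp (S + M) * δ ^ 2 =
      ∫ p : X × X, Real.exp (S + M) * δ ^ 2 * ρ p.1 p.2 ∂(α.prod β) := by
    rw [integral_const_mul, integral_density_eq_one hρ hρ1, mul_one]
  rw [← integral_fst_mul_defect hρ hρ1 hφ hψ hφ', ← integral_snd_mul_defect hρ hρ2 hφ hψ hψ',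
    h0, dualGap, dualGap, ← integral_add, ← integral_add, ← integral_add]
  · refine integral_mono (integrable_of_continuous_compact (by fun_prop))
      (integrable_of_continuous_compact (by fun_prop)) fun p => ?_
    set s := φ p.1 + ψ p.2 with hs
    set d := φ' p.1 + ψ' p.2 with hd
    have e : φ p.1 + φ' p.1 + (ψ p.2 + ψ' p.2) = s + d := by rw [hs, hd]; ring
    have h1 : Real.exp s * (Real.exp d - 1 - d) ≤ Real.exp (S + M) * δ ^ 2 := by
      have hsS : Real.exp s ≤ Real.exp S := Real.exp_le_exp.2 ((le_abs_self _).trans (hS _ _))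
      have hdd : d ^ 2 ≤ δ ^ 2 := by
        rw [← sq_abs d]
        exact pow_le_pow_left₀ (abs_nonneg _) (hδ _ _) 2
      have hdM : Real.exp |d| ≤ Real.exp M := Real.exp_le_exp.2 ((hδ _ _).trans hδM)
      calc Real.exp s * (Real.exp d - 1 - d)
          ≤ Real.exp S * (d ^ 2 * Real.exp |d|) :=
            mul_le_mul hsS (exp_sub_one_sub_le d) (by linarith [Real.add_one_le_exp d])
              (Real.exp_pos _).le
        _ ≤ Real.exp S * (δ ^ 2 * Real.exp M) := by gcongr
        _ = _ := by rw [Real.exp_add]; ring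
    have h2 := mul_le_mul_of_nonneg_left h1 (hρ0 p.1 p.2).le
    simp only [e, Real.exp_add s d]
    have h3 : φ' p.1 * (ρ p.1 p.2 * (Real.exp s - 1)) + ψ' p.2 * (ρ p.1 p.2 * (Real.exp s - 1))
        = ρ p.1 p.2 * (d * (Real.exp s - 1)) := by rw [hd]; ring
    nlinarith
  all_goals exact integrable_of_continuous_compact (by fun_prop)

/-- The gap is controlled by the defects. -/
theorem dualGap_sq_le (hρ : Continuous fun p : X × X => ρ p.1 p.2) (hρ0 : ∀ a b, 0 < ρ a b)
    (hρ1 : ∀ a, ∫ b, ρ a b ∂β = 1) (hρ2 : ∀ b, ∫ a, ρ a b ∂α = 1) (hφ : Continuous φ)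
    (hψ : Continuous ψ) {S : ℝ} (hS : ∀ a b, |φ a + ψ b| ≤ S) :
    dualGap ρ α β φ ψ ^ 2 ≤ 8 * S ^ 2 * (∫ a, defect ρ β φ ψ a ^ 2 ∂α +
      ∫ b, defect (fun b a => ρ a b) α ψ φ b ^ 2 ∂β) := by
  obtain ⟨x₀⟩ : Nonempty X := (inferInstance : NeZero α).out |> fun h => by
    by_contra hX
    rw [not_nonempty_iff] at hX
    exact h (Measure.eq_zero_of_isEmpty α)
  have hS0 : 0 ≤ S := (abs_nonneg _).trans (hS x₀ x₀)
  have hd1 : Continuous (defect ρ β φ ψ) := continuous_defect hρ hφ hψ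
  have hd2 : Continuous (defect (fun b a => ρ a b) α ψ φ) :=
    continuous_defect (hρ.comp continuous_swap) hψ hφ
  have h1 : dualGap ρ α β φ ψ ≤ ∫ a, (φ a - φ x₀) * defect ρ β φ ψ a ∂α +
      ∫ b, (ψ b + φ x₀) * defect (fun b a => ρ a b) α ψ φ b ∂β := by
    rw [← integral_fst_mul_defect hρ hρ1 hφ hψ
        (F := fun a => φ a - φ x₀) (hφ.sub continuous_const),
      ← integral_snd_mul_defect hρ hρ2 hφ hψ
        (F := fun b => ψ b + φ x₀) (hψ.add continuous_const), dualGap, ← integral_add]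
    · refine integral_mono (integrable_of_continuous_compact (by fun_prop))
        (integrable_of_continuous_compact (by fun_prop)) fun p => ?_
      set s := φ p.1 + ψ p.2 with hs
      have h2 : Real.exp s - 1 - s ≤ s * (Real.exp s - 1) := by
        have h := Real.add_one_le_exp (-s)
        have h2 := mul_le_mul_of_nonneg_right h (Real.exp_pos s).le
        rw [← Real.exp_add, neg_add_cancel, Real.exp_zero] at h2
        linarith
      have h3 := mul_le_mul_of_nonneg_left h2 (hρ0 p.1 p.2).le
      refine h3.trans (le_of_eq ?_)
      simp only [hs]
      ring
    all_goals exact integrable_of_continuous_compact (by fun_prop)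
  have hφb : ∀ a, |φ a - φ x₀| ≤ 2 * S := fun a => by
    have e : φ a - φ x₀ = (φ a + ψ x₀) - (φ x₀ + ψ x₀) := by ring
    rw [e]
    refine (abs_sub _ _).trans ?_
    linarith [hS a x₀, hS x₀ x₀]
  have hψb : ∀ b, |ψ b + φ x₀| ≤ 2 * S := fun b => by
    rw [add_comm]
    linarith [hS x₀ b]
  have key : ∀ {μ : Measure X} [IsProbabilityMeasure μ] {F h : X → ℝ}, Continuous F →
      Continuous h → (∀ a, |F a| ≤ 2 * S) → ∫ a, F a * h a ∂μ ≤ 2 * S * ∫ a, |h a| ∂μ := by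
    intro μ _ F h hF hh hb
    rw [← integral_const_mul]
    refine integral_mono (integrable_of_continuous_compact (by fun_prop))
      (integrable_of_continuous_compact (by fun_prop)) fun a => ?_
    refine (le_abs_self _).trans ?_
    rw [abs_mul]
    exact mul_le_mul_of_nonneg_right (hb a) (abs_nonneg _)
  have h4 := key (μ := α) (F := fun a => φ a - φ x₀) (hφ.sub continuous_const) hd1 hφb
  have h5 := key (μ := β) (F := fun b => ψ b + φ x₀) (hψ.add continuous_const) hd2 hψb
  have h6 := sq_integral_abs_le (μ := α) (integrable_of_continuous_compact hd1)
    (integrable_of_continuous_compact (hd1.pow 2))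
  have h7 := sq_integral_abs_le (μ := β) (integrable_of_continuous_compact hd2)
    (integrable_of_continuous_compact (hd2.pow 2))
  set A := ∫ a, |defect ρ β φ ψ a| ∂α
  set A' := ∫ b, |defect (fun b a => ρ a b) α ψ φ b| ∂β
  have h8 : dualGap ρ α β φ ψ ≤ 2 * S * (A + A') := by linarith
  calc dualGap ρ α β φ ψ ^ 2 ≤ (2 * S * (A + A')) ^ 2 :=
        pow_le_pow_left₀ (dualGap_nonneg hρ0) h8 2
    _ = 4 * S ^ 2 * (A + A') ^ 2 := by ring
    _ ≤ 4 * S ^ 2 * (2 * (A ^ 2 + A' ^ 2)) := by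
        gcongr
        nlinarith [sq_nonneg (A - A')]
    _ ≤ 4 * S ^ 2 * (2 * (∫ a, defect ρ β φ ψ a ^ 2 ∂α +
          ∫ b, defect (fun b a => ρ a b) α ψ φ b ^ 2 ∂β)) := by gcongr
    _ = _ := by ring

/-- The gap controls the `L¹` distance of the current coupling to the optimal one. -/
theorem sq_integral_abs_exp_sub_one_le (hρ : Continuous fun p : X × X => ρ p.1 p.2)
    {ρ₀ : ℝ} (hρ₀ : 0 < ρ₀) (hρle : ∀ a b, ρ₀ ≤ ρ a b) (hφ : Continuous φ) (hψ : Continuous ψ)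
    {S : ℝ} (hS : ∀ a b, |φ a + ψ b| ≤ S) :
    (∫ p : X × X, |Real.exp (φ p.1 + ψ p.2) - 1| ∂(α.prod β)) ^ 2 ≤
      Real.exp S ^ 2 * (2 * S + 4) / ρ₀ * dualGap ρ α β φ ψ := by
  refine (sq_integral_abs_le (integrable_of_continuous_compact (by fun_prop))
    (integrable_of_continuous_compact (by fun_prop))).trans ?_
  rw [dualGap, ← integral_const_mul]
  refine integral_mono (integrable_of_continuous_compact (by fun_prop))
    (integrable_of_continuous_compact (by fun_prop)) fun p => ?_
  set s := φ p.1 + ψ p.2 with hs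
  have hS0 : 0 ≤ S := (abs_nonneg _).trans (hS p.1 p.2)
  have h1 : (Real.exp s - 1) ^ 2 ≤ (Real.exp S * |s|) ^ 2 := by
    rw [← sq_abs (Real.exp s - 1)]
    exact pow_le_pow_left₀ (abs_nonneg _) (abs_exp_sub_one_le (hS _ _)) 2
  have h2 : s ^ 2 ≤ (2 * S + 4) * (Real.exp s - 1 - s) := sq_le_mul_exp_sub_one_sub (hS _ _)
  have h3 : 0 ≤ Real.exp s - 1 - s := by linarith [Real.add_one_le_exp s]
  calc (Real.exp s - 1) ^ 2 ≤ (Real.exp S * |s|) ^ 2 := h1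
    _ = Real.exp S ^ 2 * s ^ 2 := by rw [mul_pow, sq_abs]
    _ ≤ Real.exp S ^ 2 * ((2 * S + 4) * (Real.exp s - 1 - s)) := by gcongr
    _ = Real.exp S ^ 2 * (2 * S + 4) / ρ₀ * (ρ₀ * (Real.exp s - 1 - s)) := by field_simp
    _ ≤ _ := by
      gcongr
      exact hρle _ _

/-- Off the diagonal: the weighted averages of `exp ψ` at two points differ by at most the `L¹`
distance of the couplings. -/
theorem abs_integral_exp_mul_sub_le (hρ : Continuous fun p : X × X => ρ p.1 p.2)
    {ρ₁ : ℝ} (hρle : ∀ a b, |ρ a b| ≤ ρ₁)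
    (hρ1 : ∀ a, ∫ b, ρ a b ∂β = 1) (hφ : Continuous φ) (hψ : Continuous ψ)
    {S : ℝ} (hS : ∀ a b, |φ a + ψ b| ≤ S) (z z₀ : X) :
    |∫ b, Real.exp (φ z₀ + ψ b) * ρ z b ∂β - ∫ b, Real.exp (φ z₀ + ψ b) * ρ z₀ b ∂β| ≤
      Real.exp (2 * S) * (2 * ρ₁) *
        ∫ p : X × X, |Real.exp (φ p.1 + ψ p.2) - 1| ∂(α.prod β) := by
  have hρz : ∀ z, Continuous fun b => ρ z b := fun z =>
    hρ.comp (continuous_const.prodMk continuous_id)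
  have h1 := hρz z
  have h2 := hρz z₀
  have key : ∀ a, |∫ b, Real.exp (φ z₀ + ψ b) * ρ z b ∂β -
      ∫ b, Real.exp (φ z₀ + ψ b) * ρ z₀ b ∂β| ≤
      Real.exp (2 * S) * (2 * ρ₁) * ∫ b, |Real.exp (φ a + ψ b) - 1| ∂β := by
    intro a
    have e : ∫ b, Real.exp (φ z₀ + ψ b) * ρ z b ∂β - ∫ b, Real.exp (φ z₀ + ψ b) * ρ z₀ b ∂β =
        ∫ b, Real.exp (φ z₀ - φ a) * ((Real.exp (φ a + ψ b) - 1) * (ρ z b - ρ z₀ b)) ∂β := by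
      have h3 : ∀ z, Continuous (fun b => ρ z b) → ∫ b, Real.exp (φ z₀ + ψ b) * ρ z b ∂β =
          Real.exp (φ z₀ - φ a) * (∫ b, (Real.exp (φ a + ψ b) - 1) * ρ z b ∂β + 1) := by
        intro z hz
        have h4 : ∫ b, (Real.exp (φ a + ψ b) - 1) * ρ z b ∂β + 1 =
            ∫ b, ((Real.exp (φ a + ψ b) - 1) * ρ z b + ρ z b) ∂β := by
          rw [integral_add (integrable_of_continuous_compact (by fun_prop))
            (integrable_of_continuous_compact hz), hρ1]
        rw [h4, ← integral_const_mul]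
        refine integral_congr_ae (Eventually.of_forall fun b => ?_)
        have : φ z₀ + ψ b = (φ z₀ - φ a) + (φ a + ψ b) := by ring
        simp only [this, Real.exp_add]
        ring
      rw [h3 z h1, h3 z₀ h2, integral_const_mul]
      simp only [mul_sub (Real.exp (φ a + ψ _) - 1)]
      rw [integral_sub (integrable_of_continuous_compact (by fun_prop))
          (integrable_of_continuous_compact (by fun_prop))]
      ring
    rw [e, ← integral_const_mul]
    refine (abs_integral_le_integral_abs).trans (integral_mono
      (integrable_of_continuous_compact (by fun_prop))
      (integrable_of_continuous_compact (by fun_prop)) fun b => ?_)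
    simp only [abs_mul, Real.abs_exp]
    have h4 : Real.exp (φ z₀ - φ a) ≤ Real.exp (2 * S) := by
      refine Real.exp_le_exp.2 ?_
      have e : φ z₀ - φ a = (φ z₀ + ψ b) - (φ a + ψ b) := by ring
      have := abs_le.1 (hS z₀ b)
      have := abs_le.1 (hS a b)
      linarith
    have h5 : |ρ z b - ρ z₀ b| ≤ 2 * ρ₁ := by
      refine (abs_sub _ _).trans ?_
      linarith [hρle z b, hρle z₀ b]
    have h6 : 0 ≤ 2 * ρ₁ := (abs_nonneg _).trans h5
    calc _ ≤ Real.exp (2 * S) * (|Real.exp (φ a + ψ b) - 1| * (2 * ρ₁)) := by gcongr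
      _ = _ := by ring
  have h7 : ∫ p : X × X, |Real.exp (φ p.1 + ψ p.2) - 1| ∂(α.prod β) =
      ∫ a, ∫ b, |Real.exp (φ a + ψ b) - 1| ∂β ∂α :=
    integral_prod _ (integrable_of_continuous_compact (by fun_prop))
  have h8 : Continuous fun a => ∫ b, |Real.exp (φ a + ψ b) - 1| ∂β :=
    continuous_integral_right (k := fun a b => |Real.exp (φ a + ψ b) - 1|) (by fun_prop)
  rw [h7, ← integral_const_mul]
  have h9 := integral_mono (μ := α) (integrable_const _)
    (integrable_of_continuous_compact (h8.const_mul _)) key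
  simpa using h9

end Gap

section OneStep

theorem exists_log_step_bound {lo : ℝ} (hlo : 0 < lo) (hi : ℝ) :
    ∃ K : ℝ, ∀ e A : ℝ, 0 ≤ e → e ≤ 1 → lo ≤ A → A ≤ hi →
      |Real.log (1 + e * (A - 1)) - e * (A - 1)| ≤ K * e ^ 2 ∧
        |Real.log (1 + e * (A - 1))| ≤ K * e := by
  set m := min 1 lo with hm
  have hm0 : 0 < m := lt_min one_pos hlo
  refine ⟨(hi + 1) + (hi + 1) ^ 2 / m, fun e A he he1 hA hA' => ?_⟩
  have hhi : 0 < hi := hlo.trans_le (hA.trans hA')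
  have h1 : m ≤ 1 + e * (A - 1) := by
    have h2 : m ≤ 1 := min_le_left _ _
    have h3 : m ≤ A := (min_le_right _ _).trans hA
    nlinarith
  have h2 : |A - 1| ≤ hi + 1 := abs_le.2 ⟨by linarith, by linarith⟩
  have h3 : |e * (A - 1)| ≤ e * (hi + 1) := by
    rw [abs_mul, abs_of_nonneg he]
    exact mul_le_mul_of_nonneg_left h2 he
  have h4 := abs_log_one_add_sub_le hm0 h1
  have h5 : (e * (A - 1)) ^ 2 / m ≤ e ^ 2 * ((hi + 1) ^ 2 / m) := by
    rw [← sq_abs (e * (A - 1)), ← mul_div_assoc, ← mul_pow]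
    gcongr
  have h6 : e ^ 2 ≤ e := by nlinarith
  have h7 : 0 ≤ (hi + 1) ^ 2 / m := by positivity
  constructor
  · nlinarith [sq_nonneg e]
  · have h8 := abs_add_le (Real.log (1 + e * (A - 1)) - e * (A - 1)) (e * (A - 1))
    rw [sub_add_cancel] at h8
    nlinarith

theorem exists_exp_sub_one_eq_mul {S x : ℝ} (hx : |x| ≤ S) :
    ∃ θ : ℝ, Real.exp (-S) ≤ θ ∧ θ ≤ Real.exp S ∧ Real.exp x - 1 = θ * x := by
  obtain ⟨h1, h2⟩ := abs_le.1 hx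
  rcases eq_or_ne x 0 with rfl | h0
  · exact ⟨1, Real.exp_le_one_iff.2 (by linarith), Real.one_le_exp (by linarith), by simp⟩
  have hup : Real.exp x - 1 ≤ x * Real.exp x := by
    have h := Real.add_one_le_exp (-x)
    have h2 := mul_le_mul_of_nonneg_right h (Real.exp_pos x).le
    rw [← Real.exp_add, neg_add_cancel, Real.exp_zero] at h2
    linarith
  have hdn := Real.add_one_le_exp x
  have e1 : Real.exp x ≤ Real.exp S := Real.exp_le_exp.2 h2
  have e2 : Real.exp (-S) ≤ Real.exp x := Real.exp_le_exp.2 h1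
  have e3 : Real.exp (-S) ≤ 1 := Real.exp_le_one_iff.2 (by linarith)
  have e4 : 1 ≤ Real.exp S := Real.one_le_exp (by linarith)
  refine ⟨(Real.exp x - 1) / x, ?_, ?_, (div_mul_cancel₀ _ h0).symm⟩
  · rcases h0.lt_or_gt with h | h
    · rw [le_div_iff_of_neg h]
      nlinarith
    · rw [le_div_iff₀ h]
      nlinarith
  · rcases h0.lt_or_gt with h | h
    · rw [div_le_iff_of_neg h]
      nlinarith
    · rw [div_le_iff₀ h]
      nlinarith

theorem average_mem_Icc {n : ℕ} (hn : 0 < n) {c : ℕ → ℝ} {lo hi : ℝ}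
    (hc : ∀ j, lo ≤ c j ∧ c j ≤ hi) :
    lo ≤ (1 / n : ℝ) * ∑ j ∈ Finset.range n, c j ∧
      (1 / n : ℝ) * ∑ j ∈ Finset.range n, c j ≤ hi := by
  have hn' : (0 : ℝ) < n := Nat.cast_pos.2 hn
  have h1 := Finset.card_nsmul_le_sum (Finset.range n) c lo fun j _ => (hc j).1
  have h2 := Finset.sum_le_card_nsmul (Finset.range n) c hi fun j _ => (hc j).2
  rw [Finset.card_range, nsmul_eq_mul] at h1 h2
  rw [one_div_mul_eq_div, le_div_iff₀ hn', div_le_iff₀ hn']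
  constructor <;> linarith

theorem abs_integral_sub_one_le {Y : Type*} [MeasurableSpace Y] {μ : Measure Y}
    [IsProbabilityMeasure μ] {k : Y → ℝ} {hi : ℝ} (hk : Integrable k μ) (h0 : ∀ b, 0 ≤ k b) (h1 : ∀ b, k b ≤ hi) :
    |∫ b, k b ∂μ - 1| ≤ hi + 1 := by
  have h2 : 0 ≤ ∫ b, k b ∂μ := integral_nonneg h0
  have h3 : ∫ b, k b ∂μ ≤ hi := by
    refine (integral_mono hk (integrable_const hi) h1).trans ?_
    simp
  exact abs_le.2 ⟨by linarith, by linarith⟩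

variable {X : Type*} [MetricSpace X] [CompactSpace X] [MeasurableSpace X] [BorelSpace X]
  {ρ : X → X → ℝ} {α β : Measure X} [IsProbabilityMeasure α] [IsProbabilityMeasure β]

/-- One step of damped soft `C`-transforms with target densities `A`, `A'` decreases the dual gap
to first order in the step size. -/
theorem exists_dualGap_step (hρ : Continuous fun p : X × X => ρ p.1 p.2)
    (hρ0 : ∀ a b, 0 < ρ a b) (hρ1 : ∀ a, ∫ b, ρ a b ∂β = 1) (hρ2 : ∀ b, ∫ a, ρ a b ∂α = 1)
    {lo : ℝ} (hlo : 0 < lo) (hi S : ℝ) :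
    ∃ K : ℝ, ∀ φ ψ A A' : X → ℝ, Continuous φ → Continuous ψ → Continuous A → Continuous A' →
      (∀ a b, |φ a + ψ b| ≤ S) → (∀ a b, Real.exp (φ a + ψ b) * ρ a b ≤ hi) →
      (∀ a, lo ≤ A a ∧ A a ≤ hi) → (∀ b, lo ≤ A' b ∧ A' b ≤ hi) →
      ∀ e : ℝ, 0 ≤ e → e ≤ 1 →
      dualGap ρ α β (fun a => φ a + -Real.log (1 + e * (A a - 1)))
          (fun b => ψ b + -Real.log (1 + e * (A' b - 1))) ≤
        dualGap ρ α β φ ψ - e * (∫ a, (A a - 1) * defect ρ β φ ψ a ∂α +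
          ∫ b, (A' b - 1) * defect (fun b a => ρ a b) α ψ φ b ∂β) + K * e ^ 2 := by
  obtain ⟨K, hK⟩ := exists_log_step_bound hlo hi
  refine ⟨2 * (K * (hi + 1)) + Real.exp (S + 2 * K) * (2 * K) ^ 2,
    fun φ ψ A A' hφ hψ hA hA' hS hE hAb hAb' e he he1 => ?_⟩
  have hm : ∀ {A : ℝ}, lo ≤ A → 0 < 1 + e * (A - 1) := by
    intro A hA
    rcases he1.lt_or_eq with h | rfl
    · nlinarith [mul_nonneg he (hlo.le.trans hA)]
    · linarith
  have hcl : ∀ {A : X → ℝ}, Continuous A → (∀ a, lo ≤ A a ∧ A a ≤ hi) →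
      Continuous fun a => -Real.log (1 + e * (A a - 1)) := fun {A} hA hAb =>
    (Continuous.log (by fun_prop) fun a => (hm (hAb a).1).ne').neg
  have hδ : ∀ a b, |-Real.log (1 + e * (A a - 1)) + -Real.log (1 + e * (A' b - 1))|
      ≤ 2 * K * e := fun a b => by
    refine (abs_add_le _ _).trans ?_
    rw [abs_neg, abs_neg]
    linarith [(hK e _ he he1 (hAb a).1 (hAb a).2).2, (hK e _ he he1 (hAb' b).1 (hAb' b).2).2]
  obtain ⟨x₀⟩ : Nonempty X := by
    by_contra hX
    rw [not_nonempty_iff] at hX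
    exact IsProbabilityMeasure.ne_zero α (Measure.eq_zero_of_isEmpty α)
  have hK0 : 0 ≤ K := by
    have := (abs_nonneg _).trans (hK 1 _ zero_le_one le_rfl (hAb x₀).1 (hAb x₀).2).2
    linarith
  have hd1 : Continuous (defect ρ β φ ψ) := continuous_defect hρ hφ hψ
  have hd2 : Continuous (defect (fun b a => ρ a b) α ψ φ) :=
    continuous_defect (hρ.comp continuous_swap) hψ hφ
  have hb1 : ∀ a, |defect ρ β φ ψ a| ≤ hi + 1 := fun a =>
    abs_integral_sub_one_le (integrable_of_continuous_compact (by
      have : Continuous fun b => ρ a b := hρ.comp (continuous_const.prodMk continuous_id)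
      fun_prop)) (fun b => mul_nonneg (Real.exp_pos _).le (hρ0 a b).le) (hE a)
  have hb2 : ∀ b, |defect (fun b a => ρ a b) α ψ φ b| ≤ hi + 1 := fun b =>
    abs_integral_sub_one_le (integrable_of_continuous_compact (by
      have : Continuous fun a => ρ a b := hρ.comp (continuous_id.prodMk continuous_const)
      fun_prop)) (fun a => mul_nonneg (Real.exp_pos _).le (hρ0 a b).le)
      fun a => by rw [add_comm]; exact hE a b
  have key : ∀ {μ : Measure X} [IsProbabilityMeasure μ] {A d : X → ℝ}, Continuous A →
      Continuous d → (∀ a, lo ≤ A a ∧ A a ≤ hi) → (∀ a, |d a| ≤ hi + 1) →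
      ∫ a, -Real.log (1 + e * (A a - 1)) * d a ∂μ ≤
        -(e * ∫ a, (A a - 1) * d a ∂μ) + K * (hi + 1) * e ^ 2 := by
    intro μ _ A d hA hd hAb hdb
    have h1 : ∫ a, (-(e * ((A a - 1) * d a)) + K * (hi + 1) * e ^ 2) ∂μ =
        -(e * ∫ a, (A a - 1) * d a ∂μ) + K * (hi + 1) * e ^ 2 := by
      rw [integral_add (integrable_of_continuous_compact (by fun_prop)) (integrable_const _),
        integral_neg, integral_const_mul]
      simp
    rw [← h1]
    refine integral_mono (integrable_of_continuous_compact ((hcl hA hAb).mul hd))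
      (integrable_of_continuous_compact (by fun_prop)) fun a => ?_
    have h2 := (hK e _ he he1 (hAb a).1 (hAb a).2).1
    have h3 : |(Real.log (1 + e * (A a - 1)) - e * (A a - 1)) * d a| ≤
        K * e ^ 2 * (hi + 1) := by
      rw [abs_mul]
      exact mul_le_mul h2 (hdb a) (abs_nonneg _) (by positivity)
    have h4 := neg_abs_le ((Real.log (1 + e * (A a - 1)) - e * (A a - 1)) * d a)
    simp only
    linarith
  have h := dualGap_add_le hρ hρ0 hρ1 hρ2 hφ hψ (hcl hA hAb) (hcl hA' hAb') hS hδ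
    (by nlinarith : 2 * K * e ≤ 2 * K)
  have k1 := key (μ := α) hA hd1 hAb hb1
  have k2 := key (μ := β) hA' hd2 hAb' hb2
  have e1 : Real.exp (S + 2 * K) * (2 * K * e) ^ 2 =
      Real.exp (S + 2 * K) * (2 * K) ^ 2 * e ^ 2 := by ring
  linarith

theorem integral_sub_one_mul_eq {A I d : X → ℝ} (hA : Continuous A) (hI : Continuous I)
    (hd : ∀ a, d a = I a - 1) :
    ∫ a, (A a - 1) * d a ∂α = ∫ a, d a ^ 2 ∂α + ∫ a, (A a - I a) * d a ∂α := by
  have hdc : Continuous d := by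
    rw [funext hd]
    exact hI.sub continuous_const
  rw [← integral_add (integrable_of_continuous_compact (by fun_prop))
    (integrable_of_continuous_compact (by fun_prop))]
  refine integral_congr_ae (Eventually.of_forall fun a => ?_)
  simp only [hd]
  ring

/-- Fubini for the pairing of a minibatch average with a test function. -/
theorem integral_batch_sub_mul {k : X → X → ℝ} (hk : Continuous fun p : X × X => k p.1 p.2)
    {h : X → ℝ} (hh : Continuous h) (n : ℕ) (y : ℕ → X) :
    ∫ a, ((1 / n) * ∑ j ∈ Finset.range n, k a (y j) - ∫ b, k a b ∂β) * h a ∂α =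
      (1 / n) * ∑ j ∈ Finset.range n, ∫ a, k a (y j) * h a ∂α -
        ∫ b, ∫ a, k a b * h a ∂α ∂β := by
  have hkj : ∀ b, Continuous fun a => k a b := fun b =>
    hk.comp (continuous_id.prodMk continuous_const)
  have hI : Continuous fun a => ∫ b, k a b ∂β := continuous_integral_right hk
  have h1 : ∫ b, ∫ a, k a b * h a ∂α ∂β = ∫ a, (∫ b, k a b ∂β) * h a ∂α := by
    rw [integral_integral_swap]
    · simp only [integral_mul_const]
    · exact integrable_of_continuous_compact (Y := X × X) (μ := β.prod α)
        ((hk.comp continuous_swap).mul (hh.comp continuous_snd))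
  have h2 : Continuous fun a => ∑ j ∈ Finset.range n, k a (y j) * h a :=
    continuous_finsetSum (Finset.range n) fun j _ => (hkj _).mul hh
  have h3 : ∑ j ∈ Finset.range n, ∫ a, k a (y j) * h a ∂α =
      ∫ a, ∑ j ∈ Finset.range n, k a (y j) * h a ∂α :=
    (integral_finsetSum _ fun j _ => integrable_of_continuous_compact ((hkj _).mul hh)).symm
  rw [h1, h3, ← integral_const_mul, ← integral_sub (integrable_of_continuous_compact (by fun_prop))
      (integrable_of_continuous_compact (by fun_prop))]
  refine integral_congr_ae (Eventually.of_forall fun a => ?_)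
  simp only [← Finset.sum_mul]
  ring

end OneStep

section OptimalDensity

/-- The optimal coupling density with respect to `α ⊗ β`. -/
noncomputable def optimalDensity {X : Type*} (C : X → X → ℝ) (f g : X → ℝ) (a b : X) : ℝ :=
  Real.exp (f a + g b - C a b)

theorem IsOptimalPotentials.integral_right {X : Type*} [TopologicalSpace X] [MeasurableSpace X]
    {C : X → X → ℝ} {α β : Measure X} {f g : C(X, ℝ)} (h : IsOptimalPotentials C α β f g)
    (a : X) : ∫ b, optimalDensity C f g a b ∂β = 1 := by
  have := congrFun (congrArg Prod.fst h) a
  simp only [sinkhornOp, Prod.fst_zero, Pi.zero_apply, sub_eq_zero] at this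
  have e : ∀ b, optimalDensity C f g a b
      = Real.exp (f a) * (1 / Real.exp (-g b) * Real.exp (-C a b)) := by
    intro b
    rw [optimalDensity, one_div, ← Real.exp_neg, ← Real.exp_add, ← Real.exp_add]
    congr 1
    ring
  simp_rw [e]
  rw [integral_const_mul, ← this, ← Real.exp_add]
  simp

theorem IsOptimalPotentials.swap {X : Type*} [TopologicalSpace X] [MeasurableSpace X]
    {C : X → X → ℝ} {α β : Measure X} {f g : C(X, ℝ)} (h : IsOptimalPotentials C α β f g) :
    IsOptimalPotentials (fun a b => C b a) β α g f := by
  have h1 := congrArg Prod.fst h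
  have h2 := congrArg Prod.snd h
  exact Prod.ext h2 h1

theorem IsOptimalPotentials.integral_left {X : Type*} [TopologicalSpace X] [MeasurableSpace X]
    {C : X → X → ℝ} {α β : Measure X} {f g : C(X, ℝ)} (h : IsOptimalPotentials C α β f g)
    (b : X) : ∫ a, optimalDensity C f g a b ∂α = 1 := by
  rw [← h.swap.integral_right b]
  simp only [optimalDensity, add_comm]

theorem exists_abs_le_of_continuous {X : Type*} [TopologicalSpace X] [CompactSpace X]
    {k : X × X → ℝ} (hk : Continuous k) : ∃ B : ℝ, ∀ p, |k p| ≤ B := by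
  obtain ⟨B, hB⟩ := isCompact_univ.exists_bound_of_continuousOn hk.continuousOn
  exact ⟨B, fun p => hB p (Set.mem_univ p)⟩

/-- The errors of the two potentials enter the coupling density through an exponential factor. -/
theorem exp_error_mul_optimalDensity {X : Type*} {C : X → X → ℝ} {fs gs : X → ℝ} {n : ℕ}
    {η : ℕ → ℝ} (hn : 0 < n) (hη : IsRobbinsMonro η) (x y : ℕ → X) (t : ℕ)
    (a b : X) :
    Real.exp ((fIter C n η x y t a - fs a) + (gIter C n η x y t b - gs b)) *
      optimalDensity C fs gs a b = planDensity C n η x y t a b := by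
  rw [planDensity_eq_exp hn hη.nonneg hη.le_one, optimalDensity, ← Real.exp_add]
  congr 1
  ring

theorem exists_bound_error {X : Type*} [TopologicalSpace X] [CompactSpace X] {C : X → X → ℝ}
    {n : ℕ} {η : ℕ → ℝ} (hC : Continuous fun p : X × X => C p.1 p.2) (fs gs : C(X, ℝ))
    (hn : 0 < n) (hη : IsRobbinsMonro η) :
    ∃ S : ℝ, ∀ (x y : ℕ → X) (t : ℕ) (a b : X),
      |(fIter C n η x y t a - fs a) + (gIter C n η x y t b - gs b)| ≤ S := by
  obtain ⟨B, hB⟩ := exists_abs_le_of_continuous hC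
  obtain ⟨lo, hi, hlo, h⟩ := exists_bounds_planDensity (C := C) hn hη fun a b => hB (a, b)
  obtain ⟨B', hB'⟩ := exists_abs_le_of_continuous
    (k := fun p : X × X => fs p.1 + gs p.2 - C p.1 p.2) (by fun_prop)
  refine ⟨max (Real.log hi) (-Real.log lo) + B', fun x y t a b => ?_⟩
  obtain ⟨h1, h2⟩ := h x y t a b
  have hp := hlo.trans_le h1
  have e := planDensity_eq_exp (C := C) hn hη.nonneg hη.le_one x y t a b
  have h3 : Real.log (planDensity C n η x y t a b) =
      fIter C n η x y t a + gIter C n η x y t b - C a b := by rw [e, Real.log_exp]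
  have h4 := Real.log_le_log hlo h1
  have h5 := Real.log_le_log hp h2
  have h6 := abs_le.1 (hB' (a, b))
  rw [h3] at h4 h5
  have h7 := le_max_left (Real.log hi) (-Real.log lo)
  have h8 := le_max_right (Real.log hi) (-Real.log lo)
  simp only at h6
  exact abs_le.2 ⟨by linarith, by linarith⟩

end OptimalDensity

section AlmostSure

variable {X : Type*} [MetricSpace X] [CompactSpace X] [MeasurableSpace X] [BorelSpace X]
  {C : X → X → ℝ} {α β : Measure X} [IsProbabilityMeasure α] [IsProbabilityMeasure β]
  {fs gs : C(X, ℝ)} {n : ℕ} {η : ℕ → ℝ}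

/-- Test function of the first-marginal noise in the dual gap. -/
noncomputable def gapNoise (C : X → X → ℝ) (α β : Measure X) (n : ℕ) (η : ℕ → ℝ) (x y : ℕ → X)
    (t : ℕ) (b : X) : ℝ :=
  ∫ a, planDensity C n η x y t a b * (∫ b', planDensity C n η x y t a b' ∂β - 1) ∂α

theorem measurable_gapNoise (hC : Measurable fun p : X × X => C p.1 p.2) {S : Type*}
    {mS : MeasurableSpace S} {x y : ℕ → S → X} {t : ℕ}
    (hx : ∀ i < (t + 1) * n, Measurable (x i)) (hy : ∀ i < (t + 1) * n, Measurable (y i)) :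
    Measurable (Function.uncurry fun (s : S) (b : X) =>
      gapNoise C α β n η (fun i => x i s) (fun i => y i s) t b) := by
  have h := measurable_planDensity (η := η) hC hx hy
  have h1 : Measurable fun p : S × X =>
      ∫ b', planDensity C n η (fun i => x i p.1) (fun i => y i p.1) t p.2 b' ∂β := by
    refine measurable_integral_right β (S := S × X) (Ψ := fun p b' =>
      planDensity C n η (fun i => x i p.1) (fun i => y i p.1) t p.2 b') ?_
    exact h.comp (by fun_prop : Measurable fun q : (S × X) × X => (q.1.1, q.1.2, q.2))
  refine measurable_integral_right α (S := S × X) (Ψ := fun p a =>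
    planDensity C n η (fun i => x i p.1) (fun i => y i p.1) t a p.2 *
      (∫ b', planDensity C n η (fun i => x i p.1) (fun i => y i p.1) t a b' ∂β - 1)) ?_
  exact (h.comp (by fun_prop : Measurable fun q : (S × X) × X => (q.1.1, q.2, q.1.2))).mul
    ((h1.comp (by fun_prop : Measurable fun q : (S × X) × X => (q.1.1, q.2))).sub_const 1)

theorem abs_gapNoise_le (hC : Continuous fun p : X × X => C p.1 p.2) (hn : 0 < n)
    (hη : IsRobbinsMonro η) {lo hi : ℝ} (hlo : 0 < lo) {x y : ℕ → X} {t : ℕ}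
    (h : ∀ a b, lo ≤ planDensity C n η x y t a b ∧ planDensity C n η x y t a b ≤ hi) (b : X) :
    |gapNoise C α β n η x y t b| ≤ hi * (hi + 1) := by
  have hc := continuous_planDensity hC hn hη.nonneg hη.le_one x y t
  have h0 : ∀ a b, 0 ≤ planDensity C n η x y t a b := fun a b => hlo.le.trans (h a b).1
  have h1 := norm_integral_le_of_norm_le_const (μ := α) (C := hi * (hi + 1))
    (f := fun a => planDensity C n η x y t a b *
      (∫ b', planDensity C n η x y t a b' ∂β - 1)) (Eventually.of_forall fun a => by
        rw [Real.norm_eq_abs, abs_mul, abs_of_nonneg (h0 a b)]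
        refine mul_le_mul (h a b).2 (abs_integral_sub_one_le (integrable_of_continuous_compact
          (hc.comp (continuous_const.prodMk continuous_id))) (h0 a) fun b => (h a b).2)
          (abs_nonneg _) ((h0 a b).trans (h a b).2))
  simpa [gapNoise] using h1

variable {Ω : Type*} {mΩ : MeasurableSpace Ω} {P : Measure Ω} [IsProbabilityMeasure P]
  {x y : ℕ → Ω → X}

theorem ae_tendsto_dualGap (hC : Continuous fun p : X × X => C p.1 p.2)
    (hopt : IsOptimalPotentials C α β fs gs) (hn : 0 < n) (hη : IsRobbinsMonro η)
    (hx : ∀ i, Measurable (x i)) (hy : ∀ i, Measurable (y i))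
    (hxα : ∀ i, P.map (x i) = α) (hyβ : ∀ i, P.map (y i) = β)
    (hind : iIndepFun (Sum.elim x y) P) :
    ∀ᵐ ω ∂P, Tendsto (fun t => dualGap (optimalDensity C fs gs) α β
      (fun a => fIter C n η (fun i => x i ω) (fun i => y i ω) t a - fs a)
      (fun b => gIter C n η (fun i => x i ω) (fun i => y i ω) t b - gs b)) atTop (𝓝 0) := by
  have hw : ∀ i, Measurable (Sum.elim x y i) := Sum.rec hx hy
  obtain ⟨B, hB⟩ := exists_abs_le_of_continuous hC
  obtain ⟨lo, hi, hlo, h⟩ := exists_bounds_planDensity (C := C) hn hη fun a b => hB (a, b)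
  obtain ⟨S, hS⟩ := exists_bound_error hC fs gs hn hη
  have hCs : Continuous fun p : X × X => C p.2 p.1 := hC.comp continuous_swap
  have hxF : ∀ t, ∀ i < (t + 1) * n,
      Measurable[sampleFiltration n (Sum.elim x y) hw t] (x i) := fun t i hi =>
    measurable_sampleFiltration hw (i := Sum.inl i) hi
  have hyF : ∀ t, ∀ i < (t + 1) * n,
      Measurable[sampleFiltration n (Sum.elim x y) hw t] (y i) := fun t i hi =>
    measurable_sampleFiltration hw (i := Sum.inr i) hi
  have hN1 := ae_exists_tendsto_sum_batch hn hw hind hη.summable_sq (σ := Sum.inr) (μ := β)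
    (fun i => rfl) hyβ
    (Ψ := fun t ω b => gapNoise C α β n η (fun i => x i ω) (fun i => y i ω) t b)
    (fun t => measurable_gapNoise hC.measurable (hxF t) (hyF t))
    (fun t ω b => abs_gapNoise_le hC hn hη hlo (h _ _ t) b)
  have hN2 := ae_exists_tendsto_sum_batch hn hw hind hη.summable_sq (σ := Sum.inl) (μ := α)
    (fun i => rfl) hxα
    (Ψ := fun t ω a => gapNoise (fun a b => C b a) β α n η (fun i => y i ω) (fun i => x i ω) t a)
    (fun t => measurable_gapNoise hCs.measurable (hyF t) (hxF t))
    (fun t ω b => abs_gapNoise_le hCs hn hη hlo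
      (fun a b => by rw [planDensity_swap]; exact h _ _ t b a) b)
  have hρ : Continuous fun p : X × X => optimalDensity C fs gs p.1 p.2 :=
    Real.continuous_exp.comp (by fun_prop)
  have hρ0 : ∀ a b, 0 < optimalDensity C fs gs a b := fun a b => Real.exp_pos _
  obtain ⟨K, hK⟩ := exists_dualGap_step hρ hρ0 hopt.integral_right hopt.integral_left hlo hi S
  filter_upwards [hN1, hN2] with ω ⟨ℓ₁, hℓ₁⟩ ⟨ℓ₂, hℓ₂⟩
  set xs : ℕ → X := fun i => x i ω with hxs
  set ys : ℕ → X := fun i => y i ω with hys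
  set φ : ℕ → X → ℝ := fun t a => fIter C n η xs ys t a - fs a with hφ
  set ψ : ℕ → X → ℝ := fun t b => gIter C n η xs ys t b - gs b with hψ
  set ρ := optimalDensity C fs gs with hρdef
  set E := planDensity C n η xs ys with hE
  have hφc : ∀ t, Continuous (φ t) := fun t =>
    (continuous_fIter hC hn hη.nonneg hη.le_one xs ys t).sub fs.continuous
  have hψc : ∀ t, Continuous (ψ t) := fun t =>
    (continuous_gIter hC hn hη.nonneg hη.le_one xs ys t).sub gs.continuous
  have hEc : ∀ t, Continuous fun p : X × X => E t p.1 p.2 :=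
    continuous_planDensity hC hn hη.nonneg hη.le_one xs ys
  have hEeq : ∀ t a b, Real.exp (φ t a + ψ t b) * ρ a b = E t a b :=
    exp_error_mul_optimalDensity hn hη xs ys
  set d₁ : ℕ → X → ℝ := fun t => defect ρ β (φ t) (ψ t) with hd₁
  set d₂ : ℕ → X → ℝ := fun t => defect (fun b a => ρ a b) α (ψ t) (φ t) with hd₂
  have hd₁e : ∀ t a, d₁ t a = ∫ b, E t a b ∂β - 1 := fun t a => by
    simp only [hd₁, defect, hEeq]
  have hd₂e : ∀ t b, d₂ t b = ∫ a, E t a b ∂α - 1 := fun t b => by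
    simp only [hd₂, defect, add_comm (ψ t b), hEeq]
  have hd₁c : ∀ t, Continuous (d₁ t) := fun t => continuous_defect hρ (hφc t) (hψc t)
  have hd₂c : ∀ t, Continuous (d₂ t) := fun t =>
    continuous_defect (hρ.comp continuous_swap) (hψc t) (hφc t)
  set A₁ : ℕ → X → ℝ := fun t a =>
    (1 / n) * ∑ j ∈ Finset.range n, E t a (ys ((t + 1) * n + j)) with hA₁
  set A₂ : ℕ → X → ℝ := fun t b =>
    (1 / n) * ∑ j ∈ Finset.range n, E t (xs ((t + 1) * n + j)) b with hA₂
  have hA₁c : ∀ t, Continuous (A₁ t) := fun t => continuous_const.mul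
    (continuous_finsetSum (Finset.range n) fun j _ =>
      (hEc t).comp (continuous_id.prodMk continuous_const))
  have hA₂c : ∀ t, Continuous (A₂ t) := fun t => continuous_const.mul
    (continuous_finsetSum (Finset.range n) fun j _ =>
      (hEc t).comp (continuous_const.prodMk continuous_id))
  set N₁ : ℕ → ℝ := fun t => (1 / n) * ∑ j ∈ Finset.range n,
      gapNoise C α β n η xs ys t (ys ((t + 1) * n + j)) -
        ∫ b, gapNoise C α β n η xs ys t b ∂β with hN₁
  set N₂ : ℕ → ℝ := fun t => (1 / n) * ∑ j ∈ Finset.range n,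
      gapNoise (fun a b => C b a) β α n η ys xs t (xs ((t + 1) * n + j)) -
        ∫ a, gapNoise (fun a b => C b a) β α n η ys xs t a ∂α with hN₂
  have hI₁ : ∀ t, ∫ a, (A₁ t a - 1) * d₁ t a ∂α = ∫ a, d₁ t a ^ 2 ∂α + N₁ t := by
    intro t
    have h1 := integral_batch_sub_mul (α := α) (β := β) (hEc t) (hd₁c t) n
      fun j => ys ((t + 1) * n + j)
    have h2 : N₁ t = ∫ a, ((1 / n) * ∑ j ∈ Finset.range n, E t a (ys ((t + 1) * n + j)) -
        ∫ b, E t a b ∂β) * d₁ t a ∂α := by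
      rw [h1]
      simp only [hN₁, gapNoise, hd₁e, hE]
    rw [h2]
    exact integral_sub_one_mul_eq (hA₁c t) (continuous_integral_right (hEc t)) (hd₁e t)
  have hI₂ : ∀ t, ∫ b, (A₂ t b - 1) * d₂ t b ∂β = ∫ b, d₂ t b ^ 2 ∂β + N₂ t := by
    intro t
    have hEs : Continuous fun p : X × X => E t p.2 p.1 := (hEc t).comp continuous_swap
    have h1 := integral_batch_sub_mul (α := β) (β := α) (k := fun b a => E t a b) hEs (hd₂c t) n
      fun j => xs ((t + 1) * n + j)
    have h2 : N₂ t = ∫ b, ((1 / n) * ∑ j ∈ Finset.range n, E t (xs ((t + 1) * n + j)) b -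
        ∫ a, E t a b ∂α) * d₂ t b ∂β := by
      rw [h1]
      simp only [hN₂, gapNoise, hd₂e, hE, planDensity_swap]
    rw [h2]
    exact integral_sub_one_mul_eq (hA₂c t)
      (continuous_integral_right (k := fun b a => E t a b) hEs) (hd₂e t)
  set V : ℕ → ℝ := fun t => dualGap ρ α β (φ t) (ψ t) with hV
  have hVstep : ∀ t, V (t + 1) ≤ V t - η t * (∫ a, d₁ t a ^ 2 ∂α + ∫ b, d₂ t b ^ 2 ∂β) +
      (-(η t * N₁ t) - η t * N₂ t + K * η t ^ 2) := by
    intro t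
    have h1 := hK (φ t) (ψ t) (A₁ t) (A₂ t) (hφc t) (hψc t) (hA₁c t) (hA₂c t) (hS xs ys t)
      (fun a b => by rw [hEeq]; exact (h xs ys t a b).2) (fun a => average_mem_Icc hn fun j => h xs ys t _ _)
      (fun b => average_mem_Icc hn fun j => h xs ys t _ _) (η t) (hη.nonneg t) (hη.le_one t)
    have e1 : φ (t + 1) = fun a => φ t a + -Real.log (1 + η t * (A₁ t a - 1)) := by
      funext a
      simp only [hφ, hA₁, hE]
      rw [fIter_succ hn hη.nonneg hη.le_one]
      ring
    have e2 : ψ (t + 1) = fun b => ψ t b + -Real.log (1 + η t * (A₂ t b - 1)) := by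
      funext b
      simp only [hψ, hA₂, hE]
      rw [gIter_succ hn hη.nonneg hη.le_one]
      ring
    rw [← e1, ← e2] at h1
    have h2 := hI₁ t
    have h3 := hI₂ t
    simp only [hd₁, hd₂] at h2 h3
    rw [h2, h3] at h1
    simp only [hV, hd₁, hd₂]
    linarith
  have hq : ∀ t, V t ^ 2 ≤ 8 * S ^ 2 * (∫ a, d₁ t a ^ 2 ∂α + ∫ b, d₂ t b ^ 2 ∂β) := fun t =>
    dualGap_sq_le hρ hρ0 hopt.integral_right hopt.integral_left (hφc t) (hψc t) (hS xs ys t)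
  have hc : (0 : ℝ) < 1 / (8 * S ^ 2 + 1) := by positivity
  refine tendsto_zero_of_noisy_descent hη.nonneg hη.sum_eq_top hc (V := V)
    (d := fun t => -(η t * N₁ t) - η t * N₂ t + K * η t ^ 2) (fun t => dualGap_nonneg hρ0)
    (ℓ := -ℓ₁ - ℓ₂ + K * ∑' t, η t ^ 2) ?_ fun t => ?_
  · have h3 := hη.summable_sq.hasSum.tendsto_sum_nat.const_mul K
    refine ((hℓ₁.neg.sub hℓ₂).add h3).congr fun T => ?_
    rw [Finset.sum_add_distrib, Finset.sum_sub_distrib, Finset.sum_neg_distrib, Finset.mul_sum]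
    rfl
  · refine (hVstep t).trans ?_
    set G := ∫ a, d₁ t a ^ 2 ∂α + ∫ b, d₂ t b ^ 2 ∂β with hG
    have hG0 : 0 ≤ G := add_nonneg (integral_nonneg fun a => sq_nonneg _)
      (integral_nonneg fun a => sq_nonneg _)
    have h4 : 1 / (8 * S ^ 2 + 1) * V t ^ 2 ≤ G := by
      rw [one_div_mul_eq_div, div_le_iff₀ (by positivity)]
      have := hq t
      linarith
    have h5 := mul_le_mul_of_nonneg_left h4 (hη.nonneg t)
    linarith

end AlmostSure

section UniformConvergence

variable {X : Type*} [MetricSpace X] [CompactSpace X]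

/-- Equicontinuous functions that vanish at a base point and converge to zero on a dense sequence
have vanishing variation. -/
theorem eventually_varNorm_le_of_dense [Nonempty X] {φ : ℕ → X → ℝ} {q : ℕ → X}
    (hq : DenseRange q) (hequi : ∀ ε > 0, ∃ δ > 0, ∀ t z z', dist z z' < δ → |φ t z - φ t z'| ≤ ε)
    (z₀ : X) (h : ∀ i, Tendsto (fun t => φ t (q i) - φ t z₀) atTop (𝓝 0)) {ε : ℝ} (hε : 0 < ε) :
    ∀ᶠ t in atTop, varNorm (φ t) ≤ ε := by
  obtain ⟨δ, hδ, hδ'⟩ := hequi (ε / 4) (by positivity)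
  obtain ⟨s, hs⟩ := isCompact_univ.elim_finite_subcover (fun i => Metric.ball (q i) δ)
    (fun i => Metric.isOpen_ball) fun z _ => by
      obtain ⟨i, hi⟩ := hq.exists_dist_lt z hδ
      exact Set.mem_iUnion.2 ⟨i, hi⟩
  have hev : ∀ᶠ t in atTop, ∀ i ∈ s, |φ t (q i) - φ t z₀| < ε / 4 := by
    rw [Finset.eventually_all]
    intro i _
    have := (h i).abs
    rw [abs_zero] at this
    exact this.eventually (gt_mem_nhds (by positivity))
  filter_upwards [hev] with t ht
  have hz : ∀ z, |φ t z - φ t z₀| ≤ ε / 2 := by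
    intro z
    obtain ⟨i, hi⟩ := Set.mem_iUnion.1 (hs (Set.mem_univ z))
    obtain ⟨his, hi⟩ := Set.mem_iUnion.1 hi
    have h1 := hδ' t z (q i) hi
    have h2 := abs_sub_le (φ t z) (φ t (q i)) (φ t z₀)
    linarith [ht i his]
  have h1 : ⨆ z, φ t z ≤ φ t z₀ + ε / 2 := ciSup_le fun z => by
    linarith [(abs_le.1 (hz z)).2]
  have h2 : φ t z₀ - ε / 2 ≤ ⨅ z, φ t z := le_ciInf fun z => by
    linarith [(abs_le.1 (hz z)).1]
  rw [varNorm]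
  linarith

end UniformConvergence

section Main

variable {X : Type*} [MetricSpace X] [CompactSpace X] [MeasurableSpace X] [BorelSpace X]
  {C : X → X → ℝ} {α β : Measure X} [IsProbabilityMeasure α] [IsProbabilityMeasure β]
  {fs gs : C(X, ℝ)} {n : ℕ} {η : ℕ → ℝ}

/-- Along a trajectory with vanishing dual gap and convergent noise, the error of the first
potential equalises between any two points. -/
theorem tendsto_error_sub_of_dualGap (hC : Continuous fun p : X × X => C p.1 p.2)
    (hopt : IsOptimalPotentials C α β fs gs) (hn : 0 < n) (hη : IsRobbinsMonro η)
    (xs ys : ℕ → X)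
    (hV : Tendsto (fun t => dualGap (optimalDensity C fs gs) α β
      (fun a => fIter C n η xs ys t a - fs a)
      (fun b => gIter C n η xs ys t b - gs b)) atTop (𝓝 0)) (z z₀ : X) {ℓ : ℝ}
    (hℓ : Tendsto (fun T => ∑ t ∈ Finset.range T, η t *
      ((1 / n) * ∑ j ∈ Finset.range n, (planDensity C n η xs ys t z (ys ((t + 1) * n + j)) -
          planDensity C n η xs ys t z₀ (ys ((t + 1) * n + j))) -
        ∫ b, (planDensity C n η xs ys t z b - planDensity C n η xs ys t z₀ b) ∂β))
      atTop (𝓝 ℓ)) :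
    Tendsto (fun t => (fIter C n η xs ys t z - fs z) - (fIter C n η xs ys t z₀ - fs z₀))
      atTop (𝓝 0) := by
  obtain ⟨B, hB⟩ := exists_abs_le_of_continuous hC
  obtain ⟨lo, hi, hlo, h⟩ := exists_bounds_planDensity (C := C) hn hη fun a b => hB (a, b)
  obtain ⟨S, hS⟩ := exists_bound_error hC fs gs hn hη
  obtain ⟨K, hK⟩ := exists_log_step_bound hlo hi
  have hρ : Continuous fun p : X × X => optimalDensity C fs gs p.1 p.2 :=
    Real.continuous_exp.comp (by fun_prop)
  obtain ⟨ρ₁, hρ₁⟩ := exists_abs_le_of_continuous hρ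
  obtain ⟨B', hB'⟩ := exists_abs_le_of_continuous
    (k := fun p : X × X => fs p.1 + gs p.2 - C p.1 p.2) (by fun_prop)
  set φ : ℕ → X → ℝ := fun t a => fIter C n η xs ys t a - fs a with hφ
  set ψ : ℕ → X → ℝ := fun t b => gIter C n η xs ys t b - gs b with hψ
  set ρ := optimalDensity C fs gs with hρdef
  set E := planDensity C n η xs ys with hE
  have hφc : ∀ t, Continuous (φ t) := fun t =>
    (continuous_fIter hC hn hη.nonneg hη.le_one xs ys t).sub fs.continuous
  have hψc : ∀ t, Continuous (ψ t) := fun t =>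
    (continuous_gIter hC hn hη.nonneg hη.le_one xs ys t).sub gs.continuous
  have hEc : ∀ t a, Continuous (E t a) := fun t a =>
    (continuous_planDensity hC hn hη.nonneg hη.le_one xs ys t).comp
      (continuous_const.prodMk continuous_id)
  have hEi : ∀ t a, Integrable (E t a) β := fun t a => integrable_of_continuous_compact (hEc t a)
  have hEeq : ∀ t a b, Real.exp (φ t a + ψ t b) * ρ a b = E t a b :=
    exp_error_mul_optimalDensity hn hη xs ys
  set x : ℕ → ℝ := fun t => φ t z - φ t z₀ with hx
  have hxS : ∀ t, |x t| ≤ 2 * S := fun t => by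
    have e : x t = (φ t z + ψ t z₀) - (φ t z₀ + ψ t z₀) := by
      simp only [hx]
      ring
    rw [e]
    refine (abs_sub _ _).trans ?_
    linarith [hS xs ys t z z₀, hS xs ys t z₀ z₀]
  set Q : ℕ → X → ℝ := fun t a => ∫ b, Real.exp (φ t z₀ + ψ t b) * ρ a b ∂β with hQ
  have hQ₀ : ∀ t, ∫ b, E t z₀ b ∂β = Q t z₀ := fun t => by simp only [hQ, hEeq]
  have hQz : ∀ t, ∫ b, E t z b ∂β = Real.exp (x t) * Q t z := fun t => by
    simp only [hQ]
    rw [← integral_const_mul]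
    refine integral_congr_ae (Eventually.of_forall fun b => ?_)
    simp only [← hEeq]
    rw [← mul_assoc, ← Real.exp_add]
    congr 2
    simp only [hx]
    ring
  have hQlo : ∀ t, lo ≤ Q t z₀ := fun t => by
    rw [← hQ₀]
    have := integral_mono (μ := β) (integrable_const lo) (hEi t z₀) fun b => (h xs ys t z₀ b).1
    simpa using this
  have hQhi : ∀ t, Q t z₀ ≤ hi := fun t => by
    rw [← hQ₀]
    have := integral_mono (μ := β) (hEi t z₀) (integrable_const hi) fun b => (h xs ys t z₀ b).2
    simpa using this
  choose θ hθ₁ hθ₂ hθ using fun t => exists_exp_sub_one_eq_mul (hxS t)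
  have hL : Tendsto (fun t => ∫ p : X × X, |Real.exp (φ t p.1 + ψ t p.2) - 1| ∂(α.prod β)) atTop
      (𝓝 0) := by
    have hb : ∀ t, (∫ p : X × X, |Real.exp (φ t p.1 + ψ t p.2) - 1| ∂(α.prod β)) ≤
        √(Real.exp S ^ 2 * (2 * S + 4) / Real.exp (-B') * dualGap ρ α β (φ t) (ψ t)) := fun t =>
      Real.le_sqrt_of_sq_le (sq_integral_abs_exp_sub_one_le hρ (Real.exp_pos _)
        (fun a b => Real.exp_le_exp.2 (abs_le.1 (hB' (a, b))).1) (hφc t) (hψc t) (hS xs ys t))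
    have h1 := (hV.const_mul (Real.exp S ^ 2 * (2 * S + 4) / Real.exp (-B'))).sqrt
    rw [mul_zero, Real.sqrt_zero] at h1
    exact tendsto_of_tendsto_of_tendsto_of_le_of_le tendsto_const_nhds h1
      (fun t => integral_nonneg fun p => abs_nonneg _) hb
  have hQ0 : Tendsto (fun t => Q t z - Q t z₀) atTop (𝓝 0) := by
    have h1 := hL.const_mul (Real.exp (2 * S) * (2 * ρ₁))
    rw [mul_zero] at h1
    exact squeeze_zero_norm (fun t => abs_integral_exp_mul_sub_le (α := α) hρ
      (fun a b => hρ₁ (a, b)) hopt.integral_right (hφc t) (hψc t) (hS xs ys t) z z₀) h1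
  have he : Tendsto (fun t => -(Real.exp (x t) * (Q t z - Q t z₀))) atTop (𝓝 0) := by
    have h1 := hQ0.abs.const_mul (Real.exp (2 * S))
    rw [abs_zero, mul_zero] at h1
    refine squeeze_zero_norm (fun t => ?_) h1
    rw [norm_neg, Real.norm_eq_abs, abs_mul, Real.abs_exp]
    exact mul_le_mul_of_nonneg_right
      (Real.exp_le_exp.2 ((le_abs_self _).trans (hxS t))) (abs_nonneg _)
  set A : ℕ → X → ℝ := fun t a =>
    (1 / n) * ∑ j ∈ Finset.range n, E t a (ys ((t + 1) * n + j)) with hA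
  have hAb : ∀ t a, lo ≤ A t a ∧ A t a ≤ hi := fun t a =>
    average_mem_Icc hn fun j => h xs ys t _ _
  set N : ℕ → ℝ := fun t => (A t z - A t z₀) - (∫ b, E t z b ∂β - ∫ b, E t z₀ b ∂β) with hN
  have hNeq : ∀ t, (1 / n) * ∑ j ∈ Finset.range n, (E t z (ys ((t + 1) * n + j)) -
      E t z₀ (ys ((t + 1) * n + j))) - ∫ b, (E t z b - E t z₀ b) ∂β = N t := fun t => by
    rw [integral_sub (hEi t z) (hEi t z₀), Finset.sum_sub_distrib]
    simp only [hN, hA]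
    ring
  simp only [hNeq] at hℓ
  set r : ℕ → ℝ := fun t => -(Real.log (1 + η t * (A t z - 1)) - η t * (A t z - 1)) +
    (Real.log (1 + η t * (A t z₀ - 1)) - η t * (A t z₀ - 1)) with hr
  have hrb : ∀ t, |r t| ≤ 2 * K * η t ^ 2 := fun t => by
    refine (abs_add_le _ _).trans ?_
    rw [abs_neg]
    linarith [(hK _ _ (hη.nonneg t) (hη.le_one t) (hAb t z).1 (hAb t z).2).1,
      (hK _ _ (hη.nonneg t) (hη.le_one t) (hAb t z₀).1 (hAb t z₀).2).1]
  have hneg : Tendsto (fun T => ∑ t ∈ Finset.range T, -(η t * N t)) atTop (𝓝 (-ℓ)) := by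
    simpa only [Finset.sum_neg_distrib] using hℓ.neg
  obtain ⟨ℓ', hℓ'⟩ := exists_tendsto_of_abs_sub_le (b := fun t => -(η t * N t) + r t)
    (hη.summable_sq.mul_left (2 * K)) hneg fun t => by
      rw [add_sub_cancel_left]
      exact hrb t
  refine tendsto_zero_of_noisy_contraction hη.nonneg hη.tendsto_zero hη.sum_eq_top
    (c₀ := Real.exp (-(2 * S)) * lo) (c₁ := Real.exp (2 * S) * hi) (x := x)
    (θ := fun t => θ t * Q t z₀) (by positivity)
    (fun t => mul_le_mul (hθ₁ t) (hQlo t) hlo.le ((Real.exp_pos _).le.trans (hθ₁ t)))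
    (fun t => mul_le_mul (hθ₂ t) (hQhi t) (hlo.le.trans (hQlo t)) (Real.exp_pos _).le)
    he hℓ' fun t => ?_
  have hs : ∀ a, φ (t + 1) a = φ t a - Real.log (1 + η t * (A t a - 1)) := fun a => by
    simp only [hφ, hA, hE]
    rw [fIter_succ hn hη.nonneg hη.le_one]
    ring
  have e1 : x (t + 1) = x t - Real.log (1 + η t * (A t z - 1)) +
      Real.log (1 + η t * (A t z₀ - 1)) := by
    simp only [hx, hs]
    ring
  have e2 : ∫ b, E t z b ∂β - ∫ b, E t z₀ b ∂β =
      θ t * Q t z₀ * x t + Real.exp (x t) * (Q t z - Q t z₀) := by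
    rw [hQz, hQ₀]
    have := hθ t
    linear_combination Q t z₀ * this
  rw [e1]
  simp only [hr, hN, e2]
  ring

variable {Ω : Type*} {mΩ : MeasurableSpace Ω} {P : Measure Ω} [IsProbabilityMeasure P]
  {x y : ℕ → Ω → X}

theorem ae_eventually_varNorm_le {L : ℝ≥0} (hC : LipschitzWith L fun p : X × X => C p.1 p.2)
    (hopt : IsOptimalPotentials C α β fs gs) (hn : 0 < n) (hη : IsRobbinsMonro η)
    (hx : ∀ i, Measurable (x i)) (hy : ∀ i, Measurable (y i))
    (hxα : ∀ i, P.map (x i) = α) (hyβ : ∀ i, P.map (y i) = β)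
    (hind : iIndepFun (Sum.elim x y) P) {ε : ℝ} (hε : 0 < ε) :
    ∀ᵐ ω ∂P, ∀ᶠ t in atTop, varNorm (fun z =>
      fIter C n η (fun i => x i ω) (fun i => y i ω) t z - fs z) ≤ ε := by
  have hne : Nonempty X := by
    by_contra hX
    rw [not_nonempty_iff] at hX
    exact IsProbabilityMeasure.ne_zero α (Measure.eq_zero_of_isEmpty α)
  obtain ⟨z₀⟩ := id hne
  have hCc := hC.continuous
  have hw : ∀ i, Measurable (Sum.elim x y i) := Sum.rec hx hy
  obtain ⟨B, hB⟩ := exists_abs_le_of_continuous hCc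
  obtain ⟨lo, hi, hlo, h⟩ := exists_bounds_planDensity (C := C) hn hη fun a b => hB (a, b)
  set q := TopologicalSpace.denseSeq X with hq
  have hplan : ∀ t, ∀ z : X, Measurable[(sampleFiltration n (Sum.elim x y) hw t).prod ‹_›]
      fun p : Ω × X => planDensity C n η (fun i => x i p.1) (fun i => y i p.1) t z p.2 :=
    fun t z => measurable_planDensity_right hCc.measurable
      (fun i hi => measurable_sampleFiltration hw (i := Sum.inl i) hi)
      (fun i hi => measurable_sampleFiltration hw (i := Sum.inr i) hi) z
  have hnoise : ∀ᵐ ω ∂P, ∀ i, ∃ ℓ, Tendsto (fun T => ∑ t ∈ Finset.range T, η t *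
      ((1 / n) * ∑ j ∈ Finset.range n,
        (planDensity C n η (fun i => x i ω) (fun i => y i ω) t (q i) (y ((t + 1) * n + j) ω) -
          planDensity C n η (fun i => x i ω) (fun i => y i ω) t z₀ (y ((t + 1) * n + j) ω)) -
        ∫ b, (planDensity C n η (fun i => x i ω) (fun i => y i ω) t (q i) b -
          planDensity C n η (fun i => x i ω) (fun i => y i ω) t z₀ b) ∂β)) atTop (𝓝 ℓ) := by
    rw [ae_all_iff]
    intro i
    exact ae_exists_tendsto_sum_batch hn hw hind hη.summable_sq (σ := Sum.inr) (μ := β)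
      (fun i => rfl) hyβ
      (Ψ := fun t ω b => planDensity C n η (fun i => x i ω) (fun i => y i ω) t (q i) b -
        planDensity C n η (fun i => x i ω) (fun i => y i ω) t z₀ b)
      (fun t => (hplan t (q i)).sub (hplan t z₀)) (B := hi) fun t ω b => by
        have h1 := h (fun i => x i ω) (fun i => y i ω) t (q i) b
        have h2 := h (fun i => x i ω) (fun i => y i ω) t z₀ b
        exact abs_le.2 ⟨by linarith, by linarith⟩
  filter_upwards [ae_tendsto_dualGap hCc hopt hn hη hx hy hxα hyβ hind, hnoise] with ω hV hN
  refine eventually_varNorm_le_of_dense (TopologicalSpace.denseRange_denseSeq X)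
    (fun ε' hε' => ?_) z₀ (fun i => ?_) hε
  · obtain ⟨δ, hδ, hδ'⟩ := Metric.uniformContinuous_iff.1
      (CompactSpace.uniformContinuous_of_continuous fs.continuous) (ε' / 2) (by positivity)
    refine ⟨min δ (ε' / (2 * (L + 1))), by positivity, fun t z z' hz => ?_⟩
    have h1 := abs_fIter_sub_le hC hn hη.nonneg hη.le_one (fun i => x i ω) (fun i => y i ω) t z z'
    have h2 := hδ' (hz.trans_le (min_le_left _ _))
    rw [Real.dist_eq] at h2
    have h3 : L * dist z z' ≤ ε' / 2 := by
      have h4 := hz.le.trans (min_le_right _ _)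
      rw [le_div_iff₀ (by positivity)] at h4
      nlinarith [dist_nonneg (x := z) (y := z')]
    have e : ∀ a b c d : ℝ, a - b - (c - d) = (a - c) - (b - d) := fun a b c d => by ring
    rw [e]
    refine (abs_sub _ _).trans ?_
    linarith
  · obtain ⟨ℓ, hℓ⟩ := hN i
    exact tendsto_error_sub_of_dualGap hCc hopt hn hη _ _ hV (q i) z₀ hℓ

end Main

end OnlineSinkhorn

theorem mainTheorem3 (L : ℝ≥0) (D : ℝ) :
    ∃ A : ℝ, 0 < A ∧
      ∀ (X : Type*) [MetricSpace X] [CompactSpace X] [MeasurableSpace X] [BorelSpace X]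
        (C : X → X → ℝ) (α β : Measure X) [IsProbabilityMeasure α] [IsProbabilityMeasure β]
        (fstar gstar : C(X, ℝ)),
        LipschitzWith L (fun p : X × X => C p.1 p.2) →
        Metric.diam (Set.univ : Set X) ≤ D →
        OnlineSinkhorn.IsOptimalPotentials C α β fstar gstar →
        ∀ (n : ℕ), 0 < n →
        ∀ (η : ℕ → ℝ), OnlineSinkhorn.IsRobbinsMonro η →
        ∀ (Ω : Type*) [MeasurableSpace Ω] (P : Measure Ω) [IsProbabilityMeasure P]
          (x y : ℕ → Ω → X),
          (∀ i, Measurable (x i)) → (∀ i, Measurable (y i)) →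
          (∀ i, P.map (x i) = α) → (∀ i, P.map (y i) = β) →
          iIndepFun (Sum.elim x y) P →
          ∀ᵐ ω ∂P, ∃ T : ℕ, ∀ t > T,
            OnlineSinkhorn.varNorm (fun z =>
                OnlineSinkhorn.fIter C n η (fun i => x i ω) (fun i => y i ω) t z - fstar z) +
              OnlineSinkhorn.varNorm (fun z =>
                OnlineSinkhorn.gIter C n η (fun i => x i ω) (fun i => y i ω) t z - gstar z) ≤
            A / √(n : ℝ) := by
  refine ⟨1, one_pos, ?_⟩
  intro X _ _ _ _ C α β _ _ fstar gstar hC _ hopt n hn η hη Ω _ P _ x y hx hy hxα hyβ hind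
  have hn' : (0 : ℝ) < n := Nat.cast_pos.2 hn
  have hε : 0 < 1 / √(n : ℝ) / 2 := by positivity
  have hCs : LipschitzWith L fun p : X × X => C p.2 p.1 :=
    LipschitzWith.of_dist_le_mul fun p q => by
      simpa only [Prod.dist_eq, Prod.fst_swap, Prod.snd_swap, max_comm] using
        hC.dist_le_mul p.swap q.swap
  have hinds : iIndepFun (Sum.elim y x) P := by
    have h1 := hind.precomp (g := Sum.swap) Sum.swap_leftInverse.injective
    have h2 : (fun i => Sum.elim x y (Sum.swap i)) = Sum.elim y x := by
      funext i
      cases i <;> rfl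
    rwa [h2] at h1
  filter_upwards [OnlineSinkhorn.ae_eventually_varNorm_le hC hopt hn hη hx hy hxα hyβ hind hε,
    OnlineSinkhorn.ae_eventually_varNorm_le hCs hopt.swap hn hη hy hx hyβ hxα hinds hε]
    with ω h1 h2
  obtain ⟨T, hT⟩ := eventually_atTop.1 (h1.and h2)
  refine ⟨T, fun t ht => ?_⟩
  obtain ⟨h3, h4⟩ := hT t ht.le
  simp only [OnlineSinkhorn.gIter_eq_fIter_swap]
  linarith
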